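/- A looped simple graph $G=(V,E,L)$ consists of a finite simple graph $(V,E)$, whose edges join two distinct vertices, together with a finite set $L$ of loops, each incident with one vertex (several loops may be incident with the same vertex). For $X\subseteq V$ let $i(X)$ be the number of edges and loops in the subgraph of $G$ induced by $X$. For an integer $k\ge 1$, $G$ is $k$-sparse if $i(X)\le k|X|$ for all $X\subseteq V$, and $k$-tight if it is $k$-sparse and $|E\cup L|=k|V|$. It is $K_k$-free if it has no subgraph isomorphic to the complete graph $K_k$. Let $G^{[k]}$ be obtained from $G$ by adding $k$ new loops at every vertex. A linearly constrained framework in $\mathbb{R}^d$ is a triple $(G,p,q)$ with $p:V\to\mathbb{R}^d$ and $q:L\to\mathbb{R}^d$; it is generic if the family of all coordinates of $p$ and $q$ is algebraically independent over $\mathbb{Q}$. Its rigidity matrix $R(G,p,q)$ is the $(|E|+|L|)\times d|V|$ matrix in which the row of an edge $uv$ has $p(u)-p(v)$ in the $d$ columns of $u$, $p(v)-p(u)$ in the $d$ columns of $v$, and zeros elsewhere, and the row of a loop $\ell$ at $v$ has $q(\ell)$ in the $d$ columns of $v$ and zeros elsewhere. $G$ is independent in $\mathbb{R}^d$ if the rows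 of $R(G,p,q)$ are linearly independent for every generic $(G,p,q)$ in $\mathbb{R}^d$. An infinitesimal motion of $(G,p,q)$ is a map $\dot p:V\to\mathbb{R}^d$ with $(p(u)-p(v))\cdot(\dot p(u)-\dot p(v))=0$ for every edge $uv\in E$ and $q(\ell)\cdot\dot p(v)=0$ for every loop $\ell$ at a vertex $v$; $(G,p,q)$ is infinitesimally rigid if its only infinitesimal motion is $0$. **Theorem.** Let $d\ge 2$ be an integer and let $G$ be a looped simple graph. 1. If every vertex of $G$ is incident with at least $\lfloor d/2\rfloor$ loops, then $G$ is independent in $\mathbb{R}^d$ if and only if $G$ is $d$-sparse and $K_{d+2}$-free. 2. (The Cruickshank–Guler–Jackson–Nixon conjecture.) For every integer $t\ge 1$ with $d\ge 2t$, the graph $G^{[d-t]}$ can be realised as an infinitesimally rigid linearly constrained framework in $\mathbb{R}^d$ if and only if $G$ has a $t$-tight spanning looped simple subgraph. 3. If $d=2t-1$, then $G^{[d-t]}$ can be realised as an infinitesimally rigid linearly constrained framework in $\mathbb{R}^d$ if and only if $G$ has a $t$-tight $K_{d+2}$-free spanning looped simple subgraph. -/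

import Mathlib

/-- A looped simple graph `G = (V, E, L)`: a simple graph on `V` (the edge set `E`, joining pairs of
distinct vertices) and a family of loops indexed by `L`, the loop `l` being incident with the vertex
`G.base l`. Several loops may be incident with the same vertex. -/
structure LoopedGraph (V : Type*) (L : Type*) where
  graph : SimpleGraph V
  base : L → V

namespace LoopedGraph

variable {V : Type*} {L : Type*} {d : ℕ}

/-- The number of loops incident with the vertex `v`. -/
noncomputable def numLoops (G : LoopedGraph V L) (v : V) : ℕ :=
  {l : L | G.base l = v}.ncard

/-- `i(X)`: the number of edges and loops in the subgraph induced by `X`. -/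
noncomputable def inducedCount (G : LoopedGraph V L) (X : Finset V) : ℕ :=
  {e : Sym2 V | e ∈ G.graph.edgeSet ∧ ∀ v ∈ e, v ∈ X}.ncard + {l : L | G.base l ∈ X}.ncard

/-- `G` is `k`-sparse: `i(X) ≤ k |X|` for every set `X` of vertices. -/
def IsSparse (G : LoopedGraph V L) (k : ℕ) : Prop :=
  ∀ X : Finset V, G.inducedCount X ≤ k * X.card

/-- `G` is `k`-tight: it is `k`-sparse and `|E ∪ L| = k |V|`. -/
def IsTight (G : LoopedGraph V L) (k : ℕ) : Prop :=
  G.IsSparse k ∧ G.graph.edgeSet.ncard + Nat.card L = k * Nat.card V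

/-- `G` has no subgraph isomorphic to the complete graph `K_k`. -/
def CompleteFree (G : LoopedGraph V L) (k : ℕ) : Prop :=
  G.graph.CliqueFree k

/-- `G^{[k]}`: the graph obtained from `G` by adding `k` new loops at every vertex. -/
def addLoops (G : LoopedGraph V L) (k : ℕ) : LoopedGraph V (L ⊕ V × Fin k) where
  graph := G.graph
  base := Sum.elim G.base Prod.fst

/-- The spanning subgraph of `G` with edge set that of `H` and loop set `S`. -/
def spanningSubgraph (G : LoopedGraph V L) (H : SimpleGraph V) (_hH : H ≤ G.graph) (S : Set L) :
    LoopedGraph V S where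
  graph := H
  base l := G.base l

/-- The realisation `(p, q)` is generic: the family of all coordinates of `p` and of `q` is
algebraically independent over `ℚ`. -/
def IsGeneric (p : V → Fin d → ℝ) (q : L → Fin d → ℝ) : Prop :=
  AlgebraicIndependent ℚ
    (Sum.elim (fun x : V × Fin d => p x.1 x.2) (fun y : L × Fin d => q y.1 y.2))

open Classical in
/-- The rigidity matrix `R(G, p, q)`. The row of an edge `uv` has `p u - p v` in the `d` columns of
`u`, `p v - p u` in the `d` columns of `v`, and zeros elsewhere; the row of a loop `l` at `v` has
`q l` in the `d` columns of `v` and zeros elsewhere. -/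
noncomputable def rigidityMatrix (G : LoopedGraph V L) (p : V → Fin d → ℝ) (q : L → Fin d → ℝ) :
    Matrix (G.graph.edgeSet ⊕ L) (V × Fin d) ℝ :=
  Matrix.of fun r c =>
    match r with
    | Sum.inl e =>
      Sym2.lift ⟨fun u v =>
        if c.1 = u then p u c.2 - p v c.2 else if c.1 = v then p v c.2 - p u c.2 else 0, by
          intro u v
          dsimp only
          split_ifs with h1 h2
          · rw [← h1, ← h2]
          · rfl
          · rfl
          · rfl⟩ e.1
    | Sum.inr l => if c.1 = G.base l then q l c.2 else 0

/-- `G` is independent in `ℝ^d`: the rows of `R(G, p, q)` are linearly independent for every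
generic realisation `(p, q)` of `G` in `ℝ^d`. -/
def IsIndependent (G : LoopedGraph V L) (d : ℕ) : Prop :=
  ∀ (p : V → Fin d → ℝ) (q : L → Fin d → ℝ), IsGeneric p q →
    LinearIndependent ℝ (G.rigidityMatrix p q).row

/-- `m` is an infinitesimal motion of `(G, p, q)`: `(p u - p v) ⬝ (m u - m v) = 0` for all edges
`uv`, and `q l ⬝ m v = 0` for every loop `l` and its vertex `v`. -/
def IsInfinitesimalMotion (G : LoopedGraph V L) (p : V → Fin d → ℝ) (q : L → Fin d → ℝ)
    (m : V → Fin d → ℝ) : Prop :=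
  (∀ u v : V, G.graph.Adj u v → (p u - p v) ⬝ᵥ (m u - m v) = 0) ∧
    ∀ l : L, q l ⬝ᵥ m (G.base l) = 0

/-- `(G, p, q)` is infinitesimally rigid: its only infinitesimal motion is `0`. -/
def IsInfinitesimallyRigid (G : LoopedGraph V L) (p : V → Fin d → ℝ) (q : L → Fin d → ℝ) : Prop :=
  ∀ m : V → Fin d → ℝ, G.IsInfinitesimalMotion p q m → m = 0

/-- `G` is rigid in `ℝ^d`: it can be realised as an infinitesimally rigid linearly constrained
framework in `ℝ^d`. -/
def IsRigid (G : LoopedGraph V L) (d : ℕ) : Prop :=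
  ∃ (p : V → Fin d → ℝ) (q : L → Fin d → ℝ), G.IsInfinitesimallyRigid p q

end LoopedGraph

/-!
Write `t = ⌈d / 2⌉`. A graph with at least `⌊d / 2⌋` loops at each vertex is `d`-sparse exactly
when deleting `⌊d / 2⌋` loops at each vertex leaves a `t`-sparse graph `G'`, and `2 * t ≤ d + 1`.
The heart of the proof is that, when `G'` is also `K_{d+2}`-free, the generic rigidity matrix of
`G'` has a nonsingular square submatrix which uses all rows and at most `t` columns at each vertex
(`exists_linearIndependent_col`). Giving the deleted loops the unit vectors of `⌊d / 2⌋` unused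
columns at their vertices, the whole matrix becomes block triangular, hence has independent rows
at one realisation (`linearIndependent_row_of_isSparse`). As its entries are rational polynomials
in the coordinates, it then has independent rows at every generic realisation
(`linearIndependent_row_of_algebraicIndependent`).

The columns are found as follows. By Hall's theorem each edge and loop of `G'` can be given to one
of its end vertices, so that no vertex owns more than `t` of them (`exists_owner_of_isSparse`). By
Rado's theorem (`exists_linearIndependent_transversal`) one can choose for each row a column at
its owner, all these columns being independent, provided that for every vertex set `Z` the columns
at `Z` have rank at least the number of rows owned by `Z`. This holds because the rows owned by
`Z`, restricted to the columns at `Z`, are independent (`eq_zero_of_force_eq_zero`). To see this,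
take a linear dependence and remove vertices of `Z` one at a time: the (at most `d`) vectors at a
vertex of degree at most `d` are independent in a generic realisation, so their coefficients
vanish. If every degree is at least `d + 1`, then counting, with `2 * t ≤ d + 1`, shows that the
rows owned by `Z` are the edges of a `(d + 1)`-regular graph on `Z`, without loops. Finally, every
`K_{d+2}`-free graph of maximum degree at most `d + 1` has independent edges in `ℝ^d`
(`stressFree_of_cliqueFree`), by `0`- and `1`-extensions: a vertex of degree `d + 1` has two
nonadjacent neighbours, and it can be chosen so that replacing it by the edge joining them does
not create a `K_{d+2}`.

Conversely, independent rows force `d`-sparsity by counting columns, and `K_{d+2}`-freeness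
because `d + 2` points of `ℝ^d` have an affine dependence `c`, which gives the dependence with
coefficients `c u * c v` on the edges of a `K_{d+2}`. The rigidity statements follow:
infinitesimal rigidity means independent columns, so a `t`-tight subgraph with `d - t` loops added
at each vertex is rigid as soon as its square rigidity matrix has independent rows; and in a
generic rigid realisation of `G^{[d-t]}` the independent rows of the added loops extend to a row
basis, the rest of which is a `t`-tight spanning subgraph.
-/

namespace LoopedGraph

open Module

/-! ### Generic points -/

section Generic

variable {m n σ : Type*}

/-- Over `ℝ`, independence of rows is the nonvanishing of a single polynomial in the entries, the
Gram determinant. -/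
theorem linearIndependent_row_iff_det_ne_zero [Fintype m] [Fintype n] [DecidableEq m]
    (A : Matrix m n ℝ) : LinearIndependent ℝ A.row ↔ (A * A.transpose).det ≠ 0 := by
  rw [← isUnit_iff_ne_zero, ← Matrix.isUnit_iff_isUnit_det,
    ← Matrix.linearIndependent_rows_iff_isUnit, ← Matrix.vecMul_injective_iff,
    ← Matrix.vecMul_injective_iff]
  simp only [← Matrix.coe_vecMulLinear, injective_iff_map_eq_zero, Matrix.vecMulLinear_apply]
  refine forall_congr' fun v => ?_
  have := Matrix.vecMul_self_mul_conjTranspose_eq_zero A v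
  rw [Matrix.conjTranspose_eq_transpose_of_trivial] at this
  rw [this]

/-- If the rows of a matrix of rational polynomials are independent at some real point, then they
are independent at every generic point. -/
theorem linearIndependent_row_of_algebraicIndependent [Finite m] [Finite n]
    (M : (σ → ℝ) → Matrix m n ℝ)
    (hM : ∀ i j, ∃ P : MvPolynomial σ ℚ, ∀ y, M y i j = MvPolynomial.aeval y P)
    {x y : σ → ℝ} (hx : LinearIndependent ℝ (M x).row) (hy : AlgebraicIndependent ℚ y) :
    LinearIndependent ℝ (M y).row := by
  classical
  cases nonempty_fintype m
  cases nonempty_fintype n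
  choose P hP using hM
  have key : ∀ z, (M z * (M z).transpose).det =
      MvPolynomial.aeval z (Matrix.of P * (Matrix.of P).transpose).det := by
    intro z
    rw [AlgHom.map_det]
    congr 1
    ext i j
    simp [Matrix.mul_apply, hP]
  rw [linearIndependent_row_iff_det_ne_zero, key] at hx ⊢
  intro h
  have h0 : (Matrix.of P * (Matrix.of P).transpose).det = 0 :=
    hy (by simpa using h)
  exact hx (by rw [h0, map_zero])

theorem exists_algebraicIndependent_real (σ : Type*) [Finite σ] :
    ∃ y : σ → ℝ, AlgebraicIndependent ℚ y := by
  obtain ⟨s, hs⟩ := exists_isTranscendenceBasis ℚ ℝ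
  have hinf : s.Infinite := by
    intro hfin
    have := hs.isAlgebraic
    have := hfin.to_subtype
    have h1 := Cardinal.mk_congr hs.1.aevalEquiv.toEquiv
    have h2 : Cardinal.mk (MvPolynomial s ℚ) ≤ Cardinal.aleph0 :=
      MvPolynomial.cardinalMk_le_max.trans (by simp)
    have h3 := Algebra.IsAlgebraic.lift_cardinalMk_le_max
      (Algebra.adjoin ℚ (Set.range ((↑) : s → ℝ))) ℝ
    rw [← h1, Cardinal.lift_id, Cardinal.lift_id, Cardinal.mk_real, max_eq_right h2] at h3
    exact absurd h3 (not_le.2 Cardinal.aleph0_lt_continuum)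
  have := hinf.to_subtype
  obtain ⟨f⟩ : Nonempty (σ ↪ s) := by
    cases nonempty_fintype σ
    exact ⟨(Fintype.equivFin σ).toEmbedding.trans
      (Fin.valEmbedding.trans (Infinite.natEmbedding s))⟩
  exact ⟨fun i => f i, hs.1.comp f f.injective⟩

end Generic

/-! ### Rado's theorem for sets of vectors -/

/-- Rado's theorem relative to a subspace `N`. The subspace is what makes the induction of Halmos
and Vaughan for Hall's theorem work here: the vectors already chosen are absorbed into it. -/
theorem exists_transversal_finrank {K Y ι : Type*} [Field K] [AddCommGroup Y] [Module K Y]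
    [FiniteDimensional K Y] (A : ι → Set Y) (s : Finset ι) (N : Submodule K Y)
    (h : ∀ J ⊆ s, J.card + finrank K N ≤
      finrank K ↥(N ⊔ Submodule.span K (⋃ j ∈ J, A j))) :
    ∃ x : ι → Y, (∀ i ∈ s, x i ∈ A i) ∧
      s.card + finrank K N ≤ finrank K ↥(N ⊔ Submodule.span K (x '' s)) := by
  classical
  induction s using Finset.strongInduction generalizing N with
  | H s ih =>
  by_cases hs : s = ∅
  · subst hs
    exact ⟨0, by simp, by simpa using Submodule.finrank_mono le_sup_left⟩
  by_cases htight : ∃ J ⊂ s, J.Nonempty ∧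
      finrank K ↥(N ⊔ Submodule.span K (⋃ j ∈ J, A j)) = J.card + finrank K N
  · -- A tight subfamily `J` is treated first: together with `N`, its transversal spans the same
    -- space as all its vectors.
    obtain ⟨J, hJs, hJ, hJt⟩ := htight
    obtain ⟨x, hxA, hx⟩ := ih J hJs N fun J' hJ' => h J' (hJ'.trans hJs.1)
    have hle : N ⊔ Submodule.span K (x '' J) ≤ N ⊔ Submodule.span K (⋃ j ∈ J, A j) := by
      refine sup_le_sup_left (Submodule.span_mono ?_) _
      rintro _ ⟨i, hi, rfl⟩
      exact Set.mem_biUnion hi (hxA i hi)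
    have heq : N ⊔ Submodule.span K (x '' J) = N ⊔ Submodule.span K (⋃ j ∈ J, A j) :=
      Submodule.eq_of_le_of_finrank_le hle (by omega)
    obtain ⟨x', hxA', hx'⟩ := ih (s \ J) (Finset.sdiff_ssubset hJs.1 hJ)
      (N ⊔ Submodule.span K (x '' J)) (by
        intro J' hJ'
        have hd : Disjoint J' J := Finset.disjoint_of_subset_left hJ' Finset.sdiff_disjoint
        have := h (J' ∪ J) (Finset.union_subset (hJ'.trans Finset.sdiff_subset) hJs.1)
        rw [heq, hJt, sup_assoc, ← Submodule.span_union, ← Finset.set_biUnion_union,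
          Finset.union_comm]
        rw [Finset.card_union_of_disjoint hd] at this
        omega)
    refine ⟨fun i => if i ∈ J then x i else x' i, ?_, ?_⟩
    · intro i hi
      by_cases hiJ : i ∈ J
      · simpa [hiJ] using hxA i hiJ
      · simpa [hiJ] using hxA' i (Finset.mem_sdiff.2 ⟨hi, hiJ⟩)
    · have hc := Finset.card_sdiff_add_card_eq_card hJs.1
      have hmono : N ⊔ Submodule.span K (x '' J) ⊔ Submodule.span K (x' '' ↑(s \ J)) ≤
          N ⊔ Submodule.span K ((fun i => if i ∈ J then x i else x' i) '' s) := by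
        rw [sup_assoc, ← Submodule.span_union]
        refine sup_le_sup_left (Submodule.span_mono ?_) _
        rintro _ (⟨i, hi, rfl⟩ | ⟨i, hi, rfl⟩)
        · exact ⟨i, hJs.1 hi, if_pos hi⟩
        · have hi' := Finset.mem_sdiff.1 (Finset.mem_coe.1 hi)
          exact ⟨i, hi'.1, if_neg hi'.2⟩
      have := Submodule.finrank_mono hmono
      omega
  · push Not at htight
    -- No proper subfamily is tight, so any vector of `A i` outside `N` may be chosen for `i`.
    obtain ⟨i, hi⟩ := Finset.nonempty_iff_ne_empty.2 hs
    obtain ⟨a, haA, haN⟩ : ∃ a ∈ A i, a ∉ N := by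
      by_contra! hcon
      have h1 := h {i} (by simpa using hi)
      have h2 : N ⊔ Submodule.span K (⋃ j ∈ ({i} : Finset ι), A j) = N :=
        sup_eq_left.2 (Submodule.span_le.2 (by simpa [Set.subset_def] using hcon))
      rw [h2] at h1
      simp at h1
    have hN' : finrank K ↥(N ⊔ Submodule.span K {a}) = finrank K N + 1 :=
      Submodule.finrank_sup_span_singleton haN
    obtain ⟨x, hxA, hx⟩ := ih (s.erase i) (Finset.erase_ssubset hi)
      (N ⊔ Submodule.span K {a}) (by
        intro J hJ
        rcases J.eq_empty_or_nonempty with rfl | hJne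
        · simpa using Submodule.finrank_mono le_sup_left
        have hJs : J ⊂ s := lt_of_le_of_lt hJ (Finset.erase_ssubset hi)
        have h1 := h J hJs.1
        have h2 := htight J hJs hJne
        have h3 : N ⊔ Submodule.span K (⋃ j ∈ J, A j) ≤
          N ⊔ Submodule.span K {a} ⊔ Submodule.span K (⋃ j ∈ J, A j) :=
          sup_le_sup_right le_sup_left _
        have := Submodule.finrank_mono h3
        omega)
    refine ⟨Function.update x i a, ?_, ?_⟩
    · intro j hj
      by_cases hji : j = i
      · subst hji; simpa using haA
      · simpa [hji] using hxA j (Finset.mem_erase.2 ⟨hji, hj⟩)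
    · have hc := Finset.card_erase_add_one hi
      have hmono : N ⊔ Submodule.span K {a} ⊔ Submodule.span K (x '' ↑(s.erase i)) ≤
          N ⊔ Submodule.span K (Function.update x i a '' s) := by
        rw [sup_assoc, ← Submodule.span_union]
        refine sup_le_sup_left (Submodule.span_mono ?_) _
        rintro _ (hj | ⟨j, hj, rfl⟩)
        · rw [Set.mem_singleton_iff.1 hj]
          exact ⟨i, hi, by simp⟩
        · have hj' := Finset.mem_erase.1 (Finset.mem_coe.1 hj)
          exact ⟨j, hj'.2, by simp [hj'.1]⟩
      have := Submodule.finrank_mono hmono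
      omega

/-- Rado's theorem for sets of vectors. -/
theorem exists_linearIndependent_transversal {K Y ι : Type*} [Field K] [AddCommGroup Y]
    [Module K Y] [FiniteDimensional K Y] [Fintype ι] (A : ι → Set Y)
    (h : ∀ J : Finset ι, J.card ≤ finrank K (Submodule.span K (⋃ j ∈ J, A j))) :
    ∃ x : ι → Y, (∀ i, x i ∈ A i) ∧ LinearIndependent K x := by
  obtain ⟨x, hxA, hx⟩ := exists_transversal_finrank (K := K) A Finset.univ ⊥ (by
    intro J _
    rw [bot_sup_eq, finrank_bot, add_zero]
    exact h J)
  refine ⟨x, fun i => hxA i (Finset.mem_univ i), ?_⟩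
  rw [linearIndependent_iff_card_le_finrank_span]
  rw [bot_sup_eq, finrank_bot, add_zero, Finset.coe_univ, Set.image_univ] at hx
  exact hx

variable {V L : Type*} {d : ℕ}

/-! ### Stresses -/

open Classical in
/-- The resultant force at the vertex `v` (its `i`-th coordinate) of the coefficients `ω` on the
edges and `lam` on the loops: the entry in column `(v, i)` of the corresponding combination of
rows of the rigidity matrix. The coefficients of edges are encoded as a function of ordered pairs
of vertices, which is meant to be symmetric and to vanish off the edges. -/
noncomputable def force [Fintype V] [Fintype L] (b : L → V) (p : V → Fin d → ℝ)
    (q : L → Fin d → ℝ) (ω : V → V → ℝ) (lam : L → ℝ) (v : V) (i : Fin d) : ℝ :=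
  ∑ u, ω u v * (p v i - p u i) + ∑ l, if b l = v then lam l * q l i else 0

theorem sum_mul_rigidityMatrix [Fintype V] [Fintype L] (G : LoopedGraph V L)
    [Fintype G.graph.edgeSet] (p : V → Fin d → ℝ) (q : L → Fin d → ℝ) (ω : V → V → ℝ)
    (lam : L → ℝ) (hsymm : ∀ u v, ω u v = ω v u)
    (hsupp : ∀ u v, ¬ G.graph.Adj u v → ω u v = 0) (v : V) (i : Fin d) :
    ∑ r, Sum.elim (fun e : G.graph.edgeSet => Sym2.lift ⟨ω, hsymm⟩ e.1) lam r *
      G.rigidityMatrix p q r (v, i) = force G.base p q ω lam v i := by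
  classical
  rw [Fintype.sum_sum_type, force]
  congr 1
  · -- only the pairs containing `v` contribute, and these are parametrised by the other end
    let F : Sym2 V → ℝ := fun e => Sym2.lift ⟨ω, hsymm⟩ e *
      Sym2.lift ⟨fun a c =>
        if v = a then p a i - p c i else if v = c then p c i - p a i else 0, by
          intro a c
          dsimp only
          split_ifs with h1 h2
          · rw [← h1, ← h2]
          · rfl
          · rfl
          · rfl⟩ e
    have h1 : ∑ e : G.graph.edgeSet, F e.1 = ∑ e : Sym2 V, F e := by
      refine Fintype.sum_of_injective Subtype.val Subtype.val_injective _ _ ?_ fun _ => rfl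
      intro e he
      induction e with
      | h a c =>
        have : ¬ G.graph.Adj a c := fun h => he ⟨⟨s(a, c), h⟩, rfl⟩
        simp [F, hsupp a c this]
    have h2 : ∑ u, ω u v * (p v i - p u i) = ∑ e : Sym2 V, F e := by
      refine Fintype.sum_of_injective (fun u => s(u, v)) ?_ _ _ ?_ ?_
      · intro a c h
        rcases (by simpa using h : a = c ∨ a = v ∧ v = c) with h | ⟨h1, h2⟩
        · exact h
        · exact h1.trans h2
      · intro e he
        induction e with
        | h a c =>
          have ha : v ≠ a := by
            rintro rfl
            exact he ⟨c, Sym2.eq_swap⟩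
          have hc : v ≠ c := by
            rintro rfl
            exact he ⟨a, rfl⟩
          simp [F, ha, hc]
      · intro u
        by_cases h : v = u
        · simp [F, h]
        · simp [F, h]
    rw [h2, ← h1]
    rfl
  · refine Finset.sum_congr rfl fun l _ => ?_
    simp only [Sum.elim_inr, rigidityMatrix, Matrix.of_apply, mul_ite, mul_zero]
    exact if_congr eq_comm rfl rfl

/-- Every family of coefficients of the rows of the rigidity matrix comes from a symmetric
function on pairs of vertices. -/
theorem exists_symm_of_row_coeff [Fintype V] [Fintype L] (G : LoopedGraph V L)
    [Fintype G.graph.edgeSet] (g : G.graph.edgeSet ⊕ L → ℝ) :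
    ∃ ω : V → V → ℝ, (∀ u v, ω u v = ω v u) ∧ (∀ u v, ¬ G.graph.Adj u v → ω u v = 0) ∧
      (∀ u v (h : G.graph.Adj u v), ω u v = g (Sum.inl ⟨s(u, v), h⟩)) ∧
      ∀ (p : V → Fin d → ℝ) (q : L → Fin d → ℝ) v i,
        ∑ r, g r * G.rigidityMatrix p q r (v, i) =
          force G.base p q ω (fun l => g (Sum.inr l)) v i := by
  classical
  let ω : V → V → ℝ := fun u v =>
    if h : G.graph.Adj u v then g (Sum.inl ⟨s(u, v), h⟩) else 0
  have hsymm : ∀ u v, ω u v = ω v u := by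
    intro u v
    by_cases h : G.graph.Adj u v
    · have h' := h.symm
      simp only [ω, h, h', dif_pos]
      congr 3
      exact Sym2.eq_swap
    · have h' : ¬ G.graph.Adj v u := fun h' => h h'.symm
      simp only [ω, h, h', dif_neg, not_false_iff]
  have hsupp : ∀ u v, ¬ G.graph.Adj u v → ω u v = 0 := fun u v h => dif_neg h
  refine ⟨ω, hsymm, hsupp, fun u v h => dif_pos h, fun p q v i => ?_⟩
  rw [← sum_mul_rigidityMatrix G p q ω (fun l => g (Sum.inr l)) hsymm hsupp v i]
  refine Finset.sum_congr rfl fun r _ => ?_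
  congr 1
  rcases r with ⟨e, he⟩ | l
  · induction e with
    | h a c =>
      have h1 : ω a c = g (Sum.inl ⟨s(a, c), he⟩) := dif_pos he
      exact h1.symm
  · rfl

theorem linearIndependent_row_iff_force [Fintype V] [Fintype L] (G : LoopedGraph V L)
    (p : V → Fin d → ℝ) (q : L → Fin d → ℝ) :
    LinearIndependent ℝ (G.rigidityMatrix p q).row ↔
      ∀ (ω : V → V → ℝ) (lam : L → ℝ), (∀ u v, ω u v = ω v u) →
        (∀ u v, ¬ G.graph.Adj u v → ω u v = 0) → (∀ v i, force G.base p q ω lam v i = 0) →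
        (∀ u v, ω u v = 0) ∧ ∀ l, lam l = 0 := by
  classical
  have := Fintype.ofFinite G.graph.edgeSet
  rw [Fintype.linearIndependent_iff]
  constructor
  · intro h ω lam hsymm hsupp hf
    have h0 := h (Sum.elim (fun e : G.graph.edgeSet => Sym2.lift ⟨ω, hsymm⟩ e.1) lam) (by
      ext ⟨v, i⟩
      have := sum_mul_rigidityMatrix G p q ω lam hsymm hsupp v i
      simpa [Finset.sum_apply, hf] using this)
    refine ⟨fun u v => ?_, fun l => h0 (Sum.inr l)⟩
    by_cases huv : G.graph.Adj u v
    · exact h0 (Sum.inl ⟨s(u, v), huv⟩)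
    · exact hsupp u v huv
  · intro h g hg
    obtain ⟨ω, hsymm, hsupp, hω, hf⟩ := exists_symm_of_row_coeff (d := d) G g
    obtain ⟨h1, h2⟩ := h ω _ hsymm hsupp (fun v i => by
      rw [← hf]
      have := congrFun hg (v, i)
      simpa [Finset.sum_apply] using this)
    rintro (⟨e, he⟩ | l)
    · induction e with
      | h a c => rw [← hω a c he, h1]
    · exact h2 l

/-! ### Genericity of the rigidity matrix -/

/-- The entries of the rigidity matrix are rational polynomials in the coordinates of the
realisation. -/
theorem rigidityMatrix_apply_eq_aeval (G : LoopedGraph V L) (r : G.graph.edgeSet ⊕ L)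
    (c : V × Fin d) : ∃ P : MvPolynomial ((V × Fin d) ⊕ (L × Fin d)) ℚ,
      ∀ y : (V × Fin d) ⊕ (L × Fin d) → ℝ,
        G.rigidityMatrix (fun v i => y (Sum.inl (v, i))) (fun l i => y (Sum.inr (l, i))) r c =
          MvPolynomial.aeval y P := by
  classical
  rcases r with ⟨e, he⟩ | l
  · induction e with
    | h a b =>
      by_cases h1 : c.1 = a
      · exact ⟨MvPolynomial.X (Sum.inl (a, c.2)) - MvPolynomial.X (Sum.inl (b, c.2)), fun y => by
          simp [rigidityMatrix, h1]⟩
      by_cases h2 : c.1 = b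
      · exact ⟨MvPolynomial.X (Sum.inl (b, c.2)) - MvPolynomial.X (Sum.inl (a, c.2)), fun y => by
          rw [map_sub, MvPolynomial.aeval_X, MvPolynomial.aeval_X]
          simp only [rigidityMatrix, Matrix.of_apply, Sym2.lift_mk]
          rw [if_neg h1, if_pos h2]⟩
      · exact ⟨0, fun y => by simp [rigidityMatrix, h1, h2]⟩
  · by_cases h : c.1 = G.base l
    · exact ⟨MvPolynomial.X (Sum.inr (l, c.2)), fun y => by simp [rigidityMatrix, h]⟩
    · exact ⟨0, fun y => by simp [rigidityMatrix, h]⟩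

theorem linearIndependent_row_of_isGeneric [Finite V] [Finite L] (G : LoopedGraph V L)
    {p p' : V → Fin d → ℝ} {q q' : L → Fin d → ℝ}
    (h : LinearIndependent ℝ (G.rigidityMatrix p' q').row) (hpq : IsGeneric p q) :
    LinearIndependent ℝ (G.rigidityMatrix p q).row :=
  linearIndependent_row_of_algebraicIndependent
    (fun y : (V × Fin d) ⊕ (L × Fin d) → ℝ =>
      G.rigidityMatrix (fun v i => y (Sum.inl (v, i))) (fun l i => y (Sum.inr (l, i))))
    (G.rigidityMatrix_apply_eq_aeval)
    (x := Sum.elim (fun x => p' x.1 x.2) fun x => q' x.1 x.2)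
    (y := Sum.elim (fun x => p x.1 x.2) fun x => q x.1 x.2) h hpq

theorem linearIndependent_col_of_isGeneric [Finite V] [Finite L] (G : LoopedGraph V L)
    {p p' : V → Fin d → ℝ} {q q' : L → Fin d → ℝ}
    (h : LinearIndependent ℝ (G.rigidityMatrix p' q').col) (hpq : IsGeneric p q) :
    LinearIndependent ℝ (G.rigidityMatrix p q).col :=
  linearIndependent_row_of_algebraicIndependent
    (fun y : (V × Fin d) ⊕ (L × Fin d) → ℝ =>
      (G.rigidityMatrix (fun v i => y (Sum.inl (v, i)))
        (fun l i => y (Sum.inr (l, i)))).transpose)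
    (fun i j => G.rigidityMatrix_apply_eq_aeval j i)
    (x := Sum.elim (fun x => p' x.1 x.2) fun x => q' x.1 x.2)
    (y := Sum.elim (fun x => p x.1 x.2) fun x => q x.1 x.2) h hpq

theorem IsGeneric.comp {V' L' : Type*} {p : V → Fin d → ℝ} {q : L → Fin d → ℝ}
    (h : IsGeneric p q) {f : V' → V} {g : L' → L} (hf : f.Injective) (hg : g.Injective) :
    IsGeneric (fun v => p (f v)) (fun l => q (g l)) := by
  have := AlgebraicIndependent.comp h
    (Sum.map (Prod.map f id) (Prod.map g id) : (V' × Fin d) ⊕ (L' × Fin d) → _)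
    (Sum.map_injective.2 ⟨hf.prodMap Function.injective_id, hg.prodMap Function.injective_id⟩)
  unfold IsGeneric
  convert this using 1
  ext (x | x) <;> rfl

theorem exists_isGeneric (V L : Type*) (d : ℕ) [Finite V] [Finite L] :
    ∃ (p : V → Fin d → ℝ) (q : L → Fin d → ℝ), IsGeneric p q := by
  obtain ⟨y, hy⟩ := exists_algebraicIndependent_real ((V × Fin d) ⊕ (L × Fin d))
  refine ⟨fun v i => y (Sum.inl (v, i)), fun l i => y (Sum.inr (l, i)), ?_⟩
  unfold IsGeneric
  convert hy using 1
  ext (x | x) <;> rfl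

/-- In a generic realisation, at most `d` vectors, each of them a difference `p z - p u` for a
fixed `z` or a loop vector, are linearly independent. -/
theorem eq_zero_of_card_le_of_sum_smul_eq_zero {p : V → Fin d → ℝ} {q : L → Fin d → ℝ}
    (hpq : IsGeneric p q) {z : V} {T : Finset (V ⊕ L)} (hz : Sum.inl z ∉ T) (hT : T.card ≤ d)
    {c : V ⊕ L → ℝ} (hc : ∑ x ∈ T, c x • Sum.elim (fun u => p z - p u) q x = 0) :
    ∀ x ∈ T, c x = 0 := by
  classical
  let M : ((V × Fin d) ⊕ (L × Fin d) → ℝ) → Matrix T (Fin d) ℝ := fun y => Matrix.of fun x i =>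
    Sum.elim (fun u => y (Sum.inl (z, i)) - y (Sum.inl (u, i))) (fun l => y (Sum.inr (l, i))) x.1
  have hM : ∀ x i, ∃ P : MvPolynomial ((V × Fin d) ⊕ (L × Fin d)) ℚ,
      ∀ y, M y x i = MvPolynomial.aeval y P := by
    rintro ⟨x | x, hx⟩ i
    · exact ⟨MvPolynomial.X (Sum.inl (z, i)) - MvPolynomial.X (Sum.inl (x, i)), by simp [M]⟩
    · exact ⟨MvPolynomial.X (Sum.inr (x, i)), by simp [M]⟩
  obtain ⟨j⟩ : Nonempty (T ↪ Fin d) := Function.Embedding.nonempty_of_card_le (by simpa using hT)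
  -- the vectors of the family can be made distinct standard basis vectors
  let y' : (V × Fin d) ⊕ (L × Fin d) → ℝ := Sum.elim
    (fun x => if h : Sum.inl x.1 ∈ T then -(Pi.single (j ⟨_, h⟩) 1 : Fin d → ℝ) x.2 else 0)
    (fun x => if h : Sum.inr x.1 ∈ T then (Pi.single (j ⟨_, h⟩) 1 : Fin d → ℝ) x.2 else 0)
  have h' : LinearIndependent ℝ (M y').row := by
    have : (M y').row = fun x => Pi.basisFun ℝ (Fin d) (j x) := by
      ext ⟨x | x, hx⟩ i
      · simp [M, y', hz, hx, Matrix.row]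
      · simp [M, y', hx, Matrix.row]
    rw [this]
    exact (Pi.basisFun ℝ (Fin d)).linearIndependent.comp j j.injective
  have h := linearIndependent_row_of_algebraicIndependent M hM h' hpq
  rw [Fintype.linearIndependent_iff] at h
  intro x hx
  refine h (fun x => c x) ?_ ⟨x, hx⟩
  rw [← hc, ← Finset.sum_coe_sort T]
  refine Finset.sum_congr rfl fun x _ => ?_
  congr 1
  rcases x with ⟨x | x, hx⟩ <;> rfl

/-! ### Graphs of maximum degree at most `d + 1` -/

/-- The edges of `H` are independent at `p`: the only equilibrium stress is zero. As in `force`, a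
stress is a symmetric function on pairs of vertices which vanishes off the edges. -/
def StressFree [Fintype V] (H : SimpleGraph V) (p : V → Fin d → ℝ) : Prop :=
  ∀ ω : V → V → ℝ, (∀ u v, ω u v = ω v u) → (∀ u v, ¬ H.Adj u v → ω u v = 0) →
    (∀ v i, ∑ u, ω u v * (p v i - p u i) = 0) → ∀ u v, ω u v = 0

/-- A graph which is stress free at one configuration of points is so at every generic one. -/
theorem StressFree.of_isGeneric [Fintype V] {H : SimpleGraph V} {p p' : V → Fin d → ℝ}
    {q : L → Fin d → ℝ} (h : StressFree H p') (hpq : IsGeneric p q) : StressFree H p := by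
  let G : LoopedGraph V Empty := ⟨H, Empty.elim⟩
  have hgen : IsGeneric p (fun l : Empty => q l.elim) :=
    hpq.comp Function.injective_id (g := Empty.elim) (fun x => x.elim)
  have h1 : LinearIndependent ℝ (G.rigidityMatrix p' (fun l : Empty => q l.elim)).row := by
    rw [linearIndependent_row_iff_force]
    intro ω lam hsymm hsupp hf
    exact ⟨h ω hsymm hsupp fun v i => by simpa [force] using hf v i, fun l => l.elim⟩
  have h2 := G.linearIndependent_row_of_isGeneric h1 hgen
  rw [linearIndependent_row_iff_force] at h2
  intro ω hsymm hsupp hf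
  exact (h2 ω (fun l => l.elim) hsymm hsupp fun v i => by simpa [force] using hf v i).1

theorem eq_zero_of_card_le_of_sum_mul_sub_eq_zero {p : V → Fin d → ℝ} {q : L → Fin d → ℝ}
    (hpq : IsGeneric p q) {z : V} {T : Finset V} (hz : z ∉ T) (hT : T.card ≤ d)
    {c : V → ℝ} (hc : ∀ i, ∑ u ∈ T, c u * (p z i - p u i) = 0) : ∀ u ∈ T, c u = 0 := by
  intro u hu
  refine eq_zero_of_card_le_of_sum_smul_eq_zero hpq (z := z) (T := T.map Function.Embedding.inl)
    (c := Sum.elim c 0) (by simpa using hz) (by simpa using hT) ?_ (Sum.inl u) (by simpa using hu)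
  ext i
  simpa [Finset.sum_apply] using hc i

/-- The graph obtained from `H` by deleting all edges at `z`. -/
def isolate (H : SimpleGraph V) (z : V) : SimpleGraph V where
  Adj u v := H.Adj u v ∧ u ≠ z ∧ v ≠ z
  symm.symm _ _ h := ⟨h.1.symm, h.2.2, h.2.1⟩
  loopless.irrefl _ h := H.irrefl h.1

/-- The graph obtained from `H` by deleting all edges at `z` and adding the edge `ab`: the inverse
of a `1`-extension. -/
def oneReduction (H : SimpleGraph V) (z a b : V) (hab : a ≠ b) : SimpleGraph V where
  Adj u v := (isolate H z).Adj u v ∨ (u = a ∧ v = b) ∨ (u = b ∧ v = a)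
  symm.symm _ _ h := by
    rcases h with h | h | h
    · exact Or.inl h.symm
    · exact Or.inr (Or.inr h.symm)
    · exact Or.inr (Or.inl h.symm)
  loopless.irrefl _ h := by
    rcases h with h | h | h
    · exact (isolate H z).irrefl h
    · exact hab (h.1.symm.trans h.2)
    · exact hab (h.2.symm.trans h.1)

/-- A clique which is new in `oneReduction H z a b` contains the new edge `ab`. -/
theorem mem_of_isNClique_oneReduction {H : SimpleGraph V} {z a b : V} {hab : a ≠ b} {n : ℕ}
    (hH : H.CliqueFree n) {K : Finset V} (hK : (oneReduction H z a b hab).IsNClique n K) :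
    a ∈ K ∧ b ∈ K := by
  by_contra hcon
  refine hH K ⟨fun u hu v hv huv => ?_, hK.card_eq⟩
  rcases hK.isClique hu hv huv with h | ⟨rfl, rfl⟩ | ⟨rfl, rfl⟩
  · exact h.1
  · exact absurd ⟨hu, hv⟩ hcon
  · exact absurd ⟨hv, hu⟩ hcon

theorem notMem_of_isNClique_oneReduction {H : SimpleGraph V} {z a b : V} {hab : a ≠ b} {n : ℕ}
    (ha : a ≠ z) (hb : b ≠ z)
    {K : Finset V} (hK : (oneReduction H z a b hab).IsNClique n K) (haK : a ∈ K) : z ∉ K := by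
  intro hz
  rcases hK.isClique hz haK ha.symm with h | h | h
  · exact h.2.1 rfl
  · exact ha h.1.symm
  · exact hb h.1.symm

open Classical in
/-- A vertex of degree `d + 1` in a `K_{d+2}`-free graph of maximum degree at most `d + 1` can be
removed by an inverse `1`-extension which stays in this class, perhaps after moving to a different
vertex. -/
theorem exists_oneReduction_cliqueFree [Fintype V] (hd : 2 ≤ d) {H : SimpleGraph V}
    (hdeg : ∀ v, (Finset.univ.filter (H.Adj v)).card ≤ d + 1) (hfree : H.CliqueFree (d + 2))
    {z : V} (hz : (Finset.univ.filter (H.Adj z)).card = d + 1) :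
    ∃ (z a b : V) (hab : a ≠ b), (Finset.univ.filter (H.Adj z)).card = d + 1 ∧ H.Adj z a ∧
      H.Adj z b ∧ ¬ H.Adj a b ∧ (oneReduction H z a b hab).CliqueFree (d + 2) := by
  obtain ⟨a, b, hza, hzb, hab, hnab⟩ : ∃ a b, H.Adj z a ∧ H.Adj z b ∧ a ≠ b ∧ ¬ H.Adj a b := by
    by_contra! hcon
    refine hfree (insert z (Finset.univ.filter (H.Adj z))) ⟨?_, ?_⟩
    · intro u hu v hv huv
      simp only [Finset.coe_insert, Finset.coe_filter, Finset.mem_univ, true_and,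
        Set.mem_insert_iff, Set.mem_ofPred_eq] at hu hv
      rcases hu with rfl | hu <;> rcases hv with rfl | hv
      · exact absurd rfl huv
      · exact hv
      · exact hu.symm
      · exact hcon u v hu hv huv
    · rw [Finset.card_insert_of_notMem (by simp), hz]
  by_cases hcf : (oneReduction H z a b hab).CliqueFree (d + 2)
  · exact ⟨z, a, b, hab, hz, hza, hzb, hnab, hcf⟩
  simp only [SimpleGraph.CliqueFree, not_forall, not_not] at hcf
  obtain ⟨K, hK⟩ := hcf
  obtain ⟨haK, hbK⟩ := mem_of_isNClique_oneReduction hfree hK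
  have hzK := notMem_of_isNClique_oneReduction hza.ne' hzb.ne' hK haK
  -- `K` is a clique of `H` up to the missing edge `ab`; its other vertices have no neighbour
  -- outside `K`
  have hKadj : ∀ x ∈ K, x ≠ a → x ≠ b → ∀ y ∈ K, x ≠ y → H.Adj x y := by
    intro x hx hxa hxb y hy hxy
    rcases hK.isClique hx hy hxy with h | h | h
    · exact h.1
    · exact absurd h.1 hxa
    · exact absurd h.1 hxb
  have hKnbr : ∀ x ∈ K, x ≠ a → x ≠ b → ∀ y, H.Adj x y → y ∈ K := by
    intro x hx hxa hxb y hy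
    have hsub : K.erase x ⊆ Finset.univ.filter (H.Adj x) := by
      intro y hy
      rw [Finset.mem_erase] at hy
      simpa using hKadj x hx hxa hxb y hy.2 hy.1.symm
    have heq := Finset.eq_of_subset_of_card_le hsub (by
      rw [Finset.card_erase_of_mem hx, hK.card_eq]
      exact hdeg x)
    have : y ∈ K.erase x := by rw [heq]; simpa using hy
    exact Finset.mem_of_mem_erase this
  have hcard : ((K.erase a).erase b).card = d := by
    rw [Finset.card_erase_of_mem (Finset.mem_erase.2 ⟨hab.symm, hbK⟩),
      Finset.card_erase_of_mem haK, hK.card_eq]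
    omega
  -- Any vertex `w` of `K` other than `a` and `b` can take the place of `z`. The second such vertex
  -- `w'` is not adjacent to `z`, which rules out a clique of size `d + 2` after the new reduction.
  obtain ⟨w, hw, w', hw', hww'⟩ := Finset.one_lt_card.1 (show 1 < ((K.erase a).erase b).card by
    omega)
  simp only [Finset.mem_erase] at hw hw'
  have hwa := hKadj w hw.2.2 hw.2.1 hw.1 a haK hw.2.1
  have hwb := hKadj w hw.2.2 hw.2.1 hw.1 b hbK hw.1
  have hsubw : K.erase w ⊆ Finset.univ.filter (H.Adj w) := by
    intro y hy
    rw [Finset.mem_erase] at hy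
    simpa using hKadj w hw.2.2 hw.2.1 hw.1 y hy.2 hy.1.symm
  have hwdeg : (Finset.univ.filter (H.Adj w)).card = d + 1 := by
    refine le_antisymm (hdeg w) ?_
    have := Finset.card_le_card hsubw
    rwa [Finset.card_erase_of_mem hw.2.2, hK.card_eq] at this
  refine ⟨w, a, b, hab, hwdeg, hwa, hwb, hnab, fun K' hK' => ?_⟩
  obtain ⟨haK', hbK'⟩ := mem_of_isNClique_oneReduction hfree hK'
  have hwK' := notMem_of_isNClique_oneReduction hwa.ne' hwb.ne' hK' haK'
  -- the neighbours of `a` in `H` are `z` and the vertices of `K` other than `a` and `b`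
  have hNa : insert z ((K.erase a).erase b) = Finset.univ.filter (H.Adj a) := by
    refine Finset.eq_of_subset_of_card_le ?_ ?_
    · intro y hy
      rcases Finset.mem_insert.1 hy with rfl | hy
      · simpa using hza.symm
      · simp only [Finset.mem_erase] at hy
        simpa using (hKadj y hy.2.2 hy.2.1 hy.1 a haK hy.2.1).symm
    · rw [Finset.card_insert_of_notMem (by simp [hzK]), hcard]
      exact hdeg a
  have hK'sub : (K'.erase a).erase b ⊆ (insert z ((K.erase a).erase b)).erase w := by
    intro y hy
    simp only [Finset.mem_erase] at hy
    have hyw : y ≠ w := fun h => hwK' (h ▸ hy.2.2)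
    refine Finset.mem_erase.2 ⟨hyw, ?_⟩
    rw [hNa]
    rcases hK'.isClique haK' hy.2.2 hy.2.1.symm with h | h | h
    · simpa using h.1
    · exact absurd h.2 hy.1
    · exact absurd h.1 hab
  have hK'eq := Finset.eq_of_subset_of_card_le hK'sub (by
    rw [Finset.card_erase_of_mem (Finset.mem_insert_of_mem (by simp [hw])),
      Finset.card_insert_of_notMem (by simp [hzK]), hcard,
      Finset.card_erase_of_mem (Finset.mem_erase.2 ⟨hab.symm, hbK'⟩),
      Finset.card_erase_of_mem haK', hK'.card_eq]
    omega)
  have hzw : z ≠ w := fun h => hzK (h ▸ hw.2.2)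
  have hzw' : z ≠ w' := fun h => hzK (h ▸ hw'.2.2)
  have hzK' : z ∈ (K'.erase a).erase b := by rw [hK'eq]; simp [hzw]
  have hwK'' : w' ∈ (K'.erase a).erase b := by rw [hK'eq]; simp [hww'.symm, hw']
  simp only [Finset.mem_erase] at hzK' hwK''
  rcases hK'.isClique hzK'.2.2 hwK''.2.2 hzw' with h | h | h
  · exact hzK (hKnbr w' hw'.2.2 hw'.2.1 hw'.1 z h.1.symm)
  · exact hza.ne h.1
  · exact hzb.ne h.1

open Classical in
/-- If the graph obtained by an inverse `1`-extension is stress free, then so is the original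
graph once `z` is placed at the midpoint of `a` and `b`: there the edges `za` and `zb` carry equal
coefficients and act on `a` and `b` like a single edge `ab`. -/
theorem StressFree.of_oneReduction [Fintype V] {H : SimpleGraph V} {p : V → Fin d → ℝ}
    {q : L → Fin d → ℝ} (hpq : IsGeneric p q) {z a b : V} {hab : a ≠ b}
    (hz : (Finset.univ.filter (H.Adj z)).card = d + 1) (hza : H.Adj z a) (hzb : H.Adj z b)
    (hnab : ¬ H.Adj a b) (h : StressFree (oneReduction H z a b hab) p) :
    StressFree H (Function.update p z fun i => (p a i + p b i) / 2) := by
  intro ω hsymm hsupp hf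
  set p' := Function.update p z fun i => (p a i + p b i) / 2 with hp'
  have hpz : ∀ i, p' z i = (p a i + p b i) / 2 := fun i => by simp [hp']
  have hpne : ∀ v, v ≠ z → p' v = p v := fun v hv => by simp [hp', hv]
  set N := Finset.univ.filter (H.Adj z) with hN
  have haN : a ∈ N := by simpa [hN] using hza
  have hbN : b ∈ N.erase a := Finset.mem_erase.2 ⟨hab.symm, by simpa [hN] using hzb⟩
  set S := ∑ u ∈ N, ω u z with hS
  -- the equilibrium at `z` in terms of the vectors `p a - p u`
  have hsum : ∀ i, ∑ u ∈ N.erase a, (ω u z - if u = b then S / 2 else 0) * (p a i - p u i) = 0 := by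
    intro i
    have h1 : ∑ u ∈ N, ω u z * ((p a i + p b i) / 2 - p u i) = 0 := by
      rw [← hf z i, Finset.sum_filter]
      refine Finset.sum_congr rfl fun u _ => ?_
      split_ifs with hu
      · rw [hpz, hpne u hu.ne']
      · rw [hsupp u z (fun h => hu h.symm), zero_mul]
    have h2 : ∑ u ∈ N, ω u z * ((p a i + p b i) / 2 - p u i) =
        ∑ u ∈ N, ω u z * (p a i - p u i) - S * ((p a i - p b i) / 2) := by
      rw [hS, Finset.sum_mul, ← Finset.sum_sub_distrib]
      exact Finset.sum_congr rfl fun u _ => by ring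
    have h3 : ∑ u ∈ N, ω u z * (p a i - p u i) = ∑ u ∈ N.erase a, ω u z * (p a i - p u i) := by
      rw [← Finset.add_sum_erase N _ haN]
      simp
    simp only [sub_mul, Finset.sum_sub_distrib, ite_mul, zero_mul, Finset.sum_ite_eq', hbN, if_true]
    rw [← h3]
    linarith
  have hc := eq_zero_of_card_le_of_sum_mul_sub_eq_zero hpq (Finset.notMem_erase a N)
    (by rw [Finset.card_erase_of_mem haN, hz]; simp) hsum
  have hother : ∀ u, u ≠ a → u ≠ b → ω u z = 0 := by
    intro u hua hub
    by_cases hu : u ∈ N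
    · simpa [hub] using hc u (Finset.mem_erase.2 ⟨hua, hu⟩)
    · exact hsupp u z fun h => hu (by simpa [hN] using h.symm)
  have hSab : S = ω a z + ω b z := by
    rw [hS, ← Finset.add_sum_erase N _ haN, ← Finset.add_sum_erase _ _ hbN,
      Finset.sum_eq_zero, add_zero]
    intro u hu
    simp only [Finset.mem_erase] at hu
    exact hother u hu.2.1 hu.1
  have hωab : ω b z = ω a z := by
    have := hc b hbN
    simp only [if_true] at this
    linarith
  have haz := hza.ne'
  have hbz := hzb.ne'
  -- the two edges at `z` act as a single edge `ab`
  let ω' : V → V → ℝ := fun u v =>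
    if (u = a ∧ v = b) ∨ (u = b ∧ v = a) then ω a z / 2 else if u = z ∨ v = z then 0 else ω u v
  have hω'ne : ∀ u v, u ≠ z → v ≠ z → ¬ ((u = a ∧ v = b) ∨ (u = b ∧ v = a)) →
      ω' u v = ω u v := by
    intro u v hu hv huv
    simp [ω', huv, hu, hv]
  have hω'z : ∀ u v, u = z ∨ v = z → ω' u v = 0 := by
    intro u v huv
    have : ¬ ((u = a ∧ v = b) ∨ (u = b ∧ v = a)) := by
      rintro (⟨rfl, rfl⟩ | ⟨rfl, rfl⟩) <;> simp_all
    simp only [ω', this, huv, if_true, if_false]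
  have hab0 : ω a b = 0 := hsupp a b hnab
  have hba0 : ω b a = 0 := hsupp b a fun h => hnab h.symm
  have key := h ω' (by
      intro u v
      have h1 : ((u = a ∧ v = b) ∨ (u = b ∧ v = a)) ↔ ((v = a ∧ u = b) ∨ (v = b ∧ u = a)) := by
        tauto
      simp only [ω', h1, or_comm (a := u = z), hsymm u v])
    (by
      intro u v huv
      have h1 : ¬ ((u = a ∧ v = b) ∨ (u = b ∧ v = a)) := fun h => huv (Or.inr h)
      by_cases h2 : u = z ∨ v = z
      · exact hω'z u v h2
      · push Not at h2
        rw [hω'ne u v h2.1 h2.2 h1]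
        exact hsupp u v fun h => huv (Or.inl ⟨h, h2.1, h2.2⟩))
    (by
      intro v i
      by_cases hvz : v = z
      · exact Finset.sum_eq_zero fun u _ => by rw [hω'z u v (Or.inr hvz), zero_mul]
      -- compare with the equilibrium of `ω` at `v`
      have hcmp : ∀ x A, (ω z v * (p v i - (p a i + p b i) / 2) = A) → (ω x v = 0) → x ≠ z →
          ω' x v * (p v i - p x i) = A →
          (∀ u, u ≠ x → u ≠ z → ω' u v = ω u v) →
          ∑ u, ω' u v * (p v i - p u i) = 0 := by
        intro x A hA hx hxz hA' hu
        have : ∀ u, ω' u v * (p v i - p u i) = ω u v * (p' v i - p' u i) +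
            ((if u = x then A else 0) - if u = z then A else 0) := by
          intro u
          by_cases hux : u = x
          · subst hux
            simp [hxz, hx, hA']
          by_cases huz : u = z
          · subst huz
            rw [hω'z u v (Or.inl rfl), hpz, hpne v hvz, hA]
            simp [hux]
          · rw [hu u hux huz, hpne v hvz, hpne u huz]
            simp [hux, huz]
        simp only [this, Finset.sum_add_distrib, Finset.sum_sub_distrib, Finset.sum_ite_eq',
          Finset.mem_univ, if_true, sub_self, add_zero]
        exact hf v i
      by_cases hva : v = a
      · subst hva
        refine hcmp b (ω v z / 2 * (p v i - p b i)) ?_ hba0 hbz ?_ ?_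
        · rw [hsymm z v]; ring
        · simp [ω']
        · intro u hub huz
          exact hω'ne u v huz hvz (by tauto)
      by_cases hvb : v = b
      · subst hvb
        refine hcmp a (ω a z / 2 * (p v i - p a i)) ?_ hab0 haz ?_ ?_
        · rw [hsymm z v, hωab]; ring
        · simp [ω']
        · intro u hua huz
          exact hω'ne u v huz hvz (by tauto)
      refine hcmp v 0 ?_ (hsupp v v (H.irrefl)) hvz (by simp) ?_
      · rw [hsymm z v, hother v hva hvb, zero_mul]
      · intro u _ huz
        exact hω'ne u v huz hvz (by tauto))
  have haz0 : ω a z = 0 := by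
    have := key a b
    simp only [ω', true_or, and_self, if_true] at this
    linarith
  have hz0 : ∀ u, ω u z = 0 := by
    intro u
    by_cases hua : u = a
    · rw [hua, haz0]
    by_cases hub : u = b
    · rw [hub, hωab, haz0]
    exact hother u hua hub
  intro u v
  by_cases huz : u = z
  · rw [huz, hsymm, hz0]
  by_cases hvz : v = z
  · rw [hvz, hz0]
  by_cases huv : (u = a ∧ v = b) ∨ (u = b ∧ v = a)
  · rcases huv with ⟨rfl, rfl⟩ | ⟨rfl, rfl⟩
    · exact hab0
    · exact hba0
  · rw [← hω'ne u v huz hvz huv, key]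

open Classical in
/-- `0`-extension: the stress vanishes on the edges at a vertex of degree at most `d`. -/
theorem StressFree.of_isolate [Fintype V] {H : SimpleGraph V} {p : V → Fin d → ℝ}
    {q : L → Fin d → ℝ} (hpq : IsGeneric p q) {z : V}
    (hz : (Finset.univ.filter (H.Adj z)).card ≤ d) (h : StressFree (isolate H z) p) :
    StressFree H p := by
  intro ω hsymm hsupp hf
  have hz0 : ∀ u, ω u z = 0 := by
    intro u
    by_cases hu : H.Adj z u
    · refine eq_zero_of_card_le_of_sum_mul_sub_eq_zero hpq (z := z)
        (T := Finset.univ.filter (H.Adj z)) (c := fun u => ω u z) (by simp) hz (fun i => ?_) u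
        (by simpa using hu)
      rw [← hf z i, Finset.sum_filter]
      refine Finset.sum_congr rfl fun u _ => ?_
      split_ifs with hu
      · rfl
      · rw [hsupp u z (fun h => hu h.symm), zero_mul]
    · exact hsupp u z fun h => hu h.symm
  refine h ω hsymm (fun u v huv => ?_) hf
  by_cases hu : u = z
  · rw [hu, hsymm, hz0]
  by_cases hv : v = z
  · rw [hv, hz0]
  exact hsupp u v fun h => huv ⟨h, hu, hv⟩

open Classical in
/-- A `K_{d+2}`-free graph of maximum degree at most `d + 1` is generically independent in `ℝ^d`.
The proof is by induction on the number of vertices which are not isolated. -/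
theorem stressFree_of_cliqueFree [Fintype V] (hd : 2 ≤ d) {p : V → Fin d → ℝ}
    {q : L → Fin d → ℝ} (hpq : IsGeneric p q) (H : SimpleGraph V)
    (hdeg : ∀ v, (Finset.univ.filter (H.Adj v)).card ≤ d + 1) (hfree : H.CliqueFree (d + 2)) :
    StressFree H p := by
  induction hn : (Finset.univ.filter fun v => ∃ u, H.Adj v u).card using Nat.strong_induction_on
    generalizing H with
  | _ n ih =>
  by_cases hempty : ∃ z w, H.Adj z w
  swap
  · push Not at hempty
    exact fun ω _ hsupp _ u v => hsupp u v (hempty u v)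
  obtain ⟨z, w, hzw⟩ := hempty
  by_cases hsmall : ∃ z, (∃ w, H.Adj z w) ∧ (Finset.univ.filter (H.Adj z)).card ≤ d
  · obtain ⟨z, hzw, hz⟩ := hsmall
    refine StressFree.of_isolate hpq hz (ih _ ?_ (isolate H z) (fun v => ?_) ?_ rfl)
    · rw [← hn]
      refine Finset.card_lt_card (Finset.ssubset_iff_of_subset ?_ |>.2 ⟨z, ?_, ?_⟩)
      · intro v hv
        simp only [Finset.mem_filter, Finset.mem_univ, true_and] at hv ⊢
        exact hv.imp fun u hu => hu.1
      · simpa using hzw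
      · rw [Finset.mem_filter]
        rintro ⟨-, u, hu⟩
        exact hu.2.1 rfl
    · refine (Finset.card_le_card fun u hu => ?_).trans (hdeg v)
      simp only [Finset.mem_filter, Finset.mem_univ, true_and] at hu ⊢
      exact hu.1
    · exact hfree.anti fun u v h => h.1
  · push Not at hsmall
    obtain ⟨z, a, b, hab, hz, hza, hzb, hnab, hcf⟩ := exists_oneReduction_cliqueFree hd hdeg hfree
      (le_antisymm (hdeg z) (hsmall z ⟨w, hzw⟩))
    refine StressFree.of_isGeneric
      (StressFree.of_oneReduction hpq (hab := hab) hz hza hzb hnab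
        (ih _ ?_ _ (fun v => ?_) hcf rfl))
      hpq
    · rw [← hn]
      refine Finset.card_lt_card (Finset.ssubset_iff_of_subset ?_ |>.2 ⟨z, ?_, ?_⟩)
      · intro v hv
        simp only [Finset.mem_filter, Finset.mem_univ, true_and] at hv ⊢
        obtain ⟨u, h | ⟨rfl, rfl⟩ | ⟨rfl, rfl⟩⟩ := hv
        · exact ⟨u, h.1⟩
        · exact ⟨z, hza.symm⟩
        · exact ⟨z, hzb.symm⟩
      · simpa using ⟨a, hza⟩
      · rw [Finset.mem_filter]
        rintro ⟨-, u, h | h | h⟩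
        · exact h.2.1 rfl
        · exact hza.ne h.1
        · exact hzb.ne h.1
    · -- at `a` and at `b` the new edge makes up for the loss of the edge to `z`
      have hswap : ∀ v x, H.Adj v z → (∀ u, (oneReduction H z a b hab).Adj v u → u ≠ x →
          H.Adj v u ∧ u ≠ z) →
          (Finset.univ.filter ((oneReduction H z a b hab).Adj v)).card ≤ d + 1 := by
        intro v x hvz hx
        have hsub : Finset.univ.filter ((oneReduction H z a b hab).Adj v) ⊆
            insert x ((Finset.univ.filter (H.Adj v)).erase z) := by
          intro u hu
          simp only [Finset.mem_filter, Finset.mem_univ, true_and] at hu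
          by_cases hux : u = x
          · simp [hux]
          · have := hx u hu hux
            simp [this]
        have hvz' : z ∈ Finset.univ.filter (H.Adj v) := by simpa using hvz
        refine (Finset.card_le_card hsub).trans ((Finset.card_insert_le _ _).trans ?_)
        rw [Finset.card_erase_add_one hvz']
        exact hdeg v
      by_cases hva : v = a
      · refine hswap v b (hva ▸ hza.symm) ?_
        rintro u (h | h | h) hub
        · exact ⟨h.1, h.2.2⟩
        · exact absurd h.2 hub
        · exact absurd (hva.symm.trans h.1) hab
      by_cases hvb : v = b
      · refine hswap v a (hvb ▸ hzb.symm) ?_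
        rintro u (h | h | h) hua
        · exact ⟨h.1, h.2.2⟩
        · exact absurd h.1 hva
        · exact absurd h.2 hua
      refine (Finset.card_le_card fun u hu => ?_).trans (hdeg v)
      simp only [Finset.mem_filter, Finset.mem_univ, true_and] at hu ⊢
      rcases hu with h | h | h
      · exact h.1
      · exact absurd h.1 hva
      · exact absurd h.1 hvb

/-! ### Orientations of sparse graphs -/

/-- In a `t`-sparse graph each edge and loop can be given to one of its ends, which owns it, so
that no vertex owns more than `t` of them: the map `f` sends a row to its owner and to one of `t`
slots there. -/
theorem exists_owner_of_isSparse [Finite V] [Finite L] {G : LoopedGraph V L} {t : ℕ}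
    (h : G.IsSparse t) : ∃ f : G.graph.edgeSet ⊕ L → V × Fin t, f.Injective ∧
      (∀ e, (f (Sum.inl e)).1 ∈ e.1) ∧ ∀ l, (f (Sum.inr l)).1 = G.base l := by
  classical
  cases nonempty_fintype V
  cases nonempty_fintype L
  let ends : G.graph.edgeSet ⊕ L → Finset V :=
    Sum.elim (fun e => Finset.univ.filter (· ∈ e.1)) fun l => {G.base l}
  obtain ⟨f, hf, hmem⟩ := (Finset.all_card_le_biUnion_card_iff_exists_injective
    fun r => ends r ×ˢ (Finset.univ : Finset (Fin t))).1 (by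
      intro S
      have hprod : (S.biUnion fun r => ends r ×ˢ (Finset.univ : Finset (Fin t))) =
          S.biUnion ends ×ˢ Finset.univ := by
        ext ⟨v, i⟩
        simp
      rw [hprod, Finset.card_product, Finset.card_univ, Fintype.card_fin, mul_comm]
      refine le_trans ?_ (h (S.biUnion ends))
      rw [← Finset.card_toLeft_add_card_toRight, inducedCount]
      refine add_le_add ?_ ?_
      · rw [← Finset.card_map (Function.Embedding.subtype _), ← Set.ncard_coe_finset]
        refine Set.ncard_le_ncard ?_ (Set.toFinite _)
        intro e he
        obtain ⟨e', he', rfl⟩ := Finset.mem_map.1 (Finset.mem_coe.1 he)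
        refine ⟨e'.2, fun v hv => Finset.mem_biUnion.2 ⟨Sum.inl e', by simpa using he', ?_⟩⟩
        simpa [ends] using hv
      · rw [← Set.ncard_coe_finset]
        refine Set.ncard_le_ncard ?_ (Set.toFinite _)
        intro l hl
        exact Finset.mem_biUnion.2 ⟨Sum.inr l, by simpa using hl, by simp [ends]⟩)
  refine ⟨f, hf, fun e => ?_, fun l => ?_⟩
  · simpa [ends] using (Finset.mem_product.1 (hmem (Sum.inl e))).1
  · simpa [ends] using (Finset.mem_product.1 (hmem (Sum.inr l))).1

/-! ### Independence of the rows owned by a set of vertices -/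

open Classical in
/-- The rows owned by `Z`, restricted to the columns at `Z`, are independent in a generic
realisation. Here `T u v` says that the edge `uv` is owned by `u`, and a loop is owned by its
vertex. -/
theorem eq_zero_of_force_eq_zero [Fintype V] [Fintype L] {G : LoopedGraph V L} (hd : 2 ≤ d)
    {t : ℕ} (ht : 2 * t ≤ d + 1) (hfree : G.graph.CliqueFree (d + 2)) {p : V → Fin d → ℝ}
    {q : L → Fin d → ℝ} (hpq : IsGeneric p q) {T : V → V → Prop}
    (hTadj : ∀ u v, T u v → G.graph.Adj u v) (hT : ∀ u v, G.graph.Adj u v → T u v ∨ T v u)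
    (hcount : ∀ v, (Finset.univ.filter (T v)).card +
      (Finset.univ.filter fun l => G.base l = v).card ≤ t)
    (Z : Finset V) {ω : V → V → ℝ} {lam : L → ℝ} (hsymm : ∀ u v, ω u v = ω v u)
    (hω : ∀ u v, ω u v ≠ 0 → (T u v ∧ u ∈ Z) ∨ (T v u ∧ v ∈ Z))
    (hlam : ∀ l, lam l ≠ 0 → G.base l ∈ Z)
    (hforce : ∀ z ∈ Z, ∀ i, force G.base p q ω lam z i = 0) :
    (∀ u v, ω u v = 0) ∧ ∀ l, lam l = 0 := by
  induction Z using Finset.strongInduction with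
  | H Z ih =>
  let N : V → Finset V := fun z => Finset.univ.filter fun u => T z u ∨ (T u z ∧ u ∈ Z)
  let Lz : V → Finset L := fun z => Finset.univ.filter fun l => G.base l = z
  by_cases hsmall : ∃ z ∈ Z, (N z).card + (Lz z).card ≤ d
  · obtain ⟨z, hz, hcard⟩ := hsmall
    have hN : ∀ u, ω u z ≠ 0 → u ∈ N z := by
      intro u hu
      simp only [N, Finset.mem_filter, Finset.mem_univ, true_and]
      exact (hω u z hu).symm.imp (fun h => h.1) id
    have hzN : z ∉ N z := by
      simp only [N, Finset.mem_filter, Finset.mem_univ, true_and]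
      rintro (h | h)
      · exact (hTadj _ _ h).ne rfl
      · exact (hTadj _ _ h.1).ne rfl
    have hc := eq_zero_of_card_le_of_sum_smul_eq_zero hpq (z := z) (T := (N z).disjSum (Lz z))
      (c := Sum.elim (fun u => ω u z) lam) (by simpa using hzN)
      (by rwa [Finset.card_disjSum]) (by
        ext i
        rw [Finset.sum_disjSum]
        simp only [Sum.elim_inl, Sum.elim_inr, Pi.add_apply, Finset.sum_apply, Pi.smul_apply,
          Pi.sub_apply, smul_eq_mul, Pi.zero_apply]
        rw [← hforce z hz i, force]
        congr 1
        · refine Finset.sum_subset (Finset.subset_univ _) fun u _ hu => ?_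
          rw [not_imp_comm.1 (hN u) hu, zero_mul]
        · rw [Finset.sum_filter])
    have hωz : ∀ u, ω u z = 0 := by
      intro u
      by_contra h
      exact h (hc (Sum.inl u) (by simpa using hN u h))
    have hlamz : ∀ l, G.base l = z → lam l = 0 := by
      intro l hl
      exact hc (Sum.inr l) (by simpa [Lz] using hl)
    refine ih (Z.erase z) (Finset.erase_ssubset hz) ?_ ?_ ?_
    · intro u v huv
      have hu : u ≠ z := by
        rintro rfl
        exact huv (by rw [hsymm, hωz])
      have hv : v ≠ z := by
        rintro rfl
        exact huv (hωz u)
      simpa [hu, hv] using hω u v huv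
    · intro l hl
      exact Finset.mem_erase.2 ⟨fun h => hl (hlamz l h), hlam l hl⟩
    · exact fun v hv => hforce v (Finset.mem_of_mem_erase hv)
  · push Not at hsmall
    -- `a z` counts the edges owned by `z`, `b z` those at `z` owned by their other end, this end
    -- being in `Z`, and `c z` those owned by `z` whose other end is in `Z`.
    let a : V → ℕ := fun z => (Finset.univ.filter (T z)).card
    let b : V → ℕ := fun z => (Z.filter fun u => T u z).card
    let c : V → ℕ := fun z => (Z.filter fun u => T z u).card
    have hbc : ∑ z ∈ Z, b z = ∑ z ∈ Z, c z := by
      simp only [b, c, Finset.card_filter]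
      rw [Finset.sum_comm]
    have hca : ∀ z, c z ≤ a z := fun z =>
      Finset.card_le_card (Finset.filter_subset_filter _ (Finset.subset_univ _))
    have hNab : ∀ z, (N z).card ≤ a z + b z := by
      intro z
      have : N z = Finset.univ.filter (T z) ∪ Z.filter fun u => T u z := by
        ext u
        simp [N, and_comm]
      rw [this]
      exact Finset.card_union_le _ _
    have h1 : ∑ z ∈ Z, (d + 1) ≤ ∑ z ∈ Z, ((N z).card + (Lz z).card) :=
      Finset.sum_le_sum fun z hz => hsmall z hz
    have h2 : ∑ z ∈ Z, ((N z).card + (Lz z).card) ≤ ∑ z ∈ Z, (a z + c z + (Lz z).card) := by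
      have : ∑ z ∈ Z, ((N z).card + (Lz z).card) ≤ ∑ z ∈ Z, (a z + b z + (Lz z).card) :=
        Finset.sum_le_sum fun z _ => Nat.add_le_add_right (hNab z) _
      simpa only [Finset.sum_add_distrib, hbc] using this
    have h3' : ∀ z ∈ Z, a z + c z + (Lz z).card ≤ d + 1 := by
      intro z _
      have h4 := hca z
      have h5 : a z + (Lz z).card ≤ t := hcount z
      omega
    have h3 := Finset.sum_le_sum h3'
    -- all the inequalities are equalities
    have e1 := (Finset.sum_eq_sum_iff_of_le fun z hz => hsmall z hz).1
      (le_antisymm h1 (h2.trans h3))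
    have e2 := (Finset.sum_eq_sum_iff_of_le h3').1 (le_antisymm h3 (h1.trans h2))
    have hL0 : ∀ z ∈ Z, (Lz z).card = 0 := by
      intro z hz
      have h4 := hca z
      have h5 : a z + (Lz z).card ≤ t := hcount z
      have h6 := e2 z hz
      omega
    have hTZ : ∀ z ∈ Z, ∀ u, T z u → u ∈ Z := by
      intro z hz u hu
      have hle : a z ≤ c z := by
        have h5 : a z + (Lz z).card ≤ t := hcount z
        have h6 := e2 z hz
        omega
      have heq := Finset.eq_of_subset_of_card_le
        (Finset.filter_subset_filter (T z) (Finset.subset_univ Z)) hle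
      have : u ∈ Z.filter fun u => T z u := by
        rw [heq]
        simpa using hu
      exact (Finset.mem_filter.1 this).1
    have hωZ : ∀ u v, ω u v ≠ 0 → u ∈ Z ∧ v ∈ Z := by
      intro u v huv
      rcases hω u v huv with ⟨h, hu⟩ | ⟨h, hv⟩
      · exact ⟨hu, hTZ u hu v h⟩
      · exact ⟨hTZ v hv u h, hv⟩
    have hlam0 : ∀ l, lam l = 0 := by
      intro l
      by_contra hl
      have := hL0 _ (hlam l hl)
      rw [Finset.card_eq_zero] at this
      have hmem : l ∈ Lz (G.base l) := by simp [Lz]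
      rw [this] at hmem
      simp at hmem
    -- The rows owned by `Z` are now the edges of the subgraph `H` induced by `Z`.
    obtain ⟨H, hHadj⟩ : ∃ H : SimpleGraph V,
        ∀ u v, H.Adj u v ↔ G.graph.Adj u v ∧ u ∈ Z ∧ v ∈ Z :=
      ⟨{ Adj := fun u v => G.graph.Adj u v ∧ u ∈ Z ∧ v ∈ Z
         symm := ⟨fun _ _ h => ⟨h.1.symm, h.2.2, h.2.1⟩⟩
         loopless := ⟨fun _ h => G.graph.irrefl h.1⟩ }, fun _ _ => Iff.rfl⟩
    have hH := stressFree_of_cliqueFree hd hpq H (fun v => by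
      by_cases hv : v ∈ Z
      · have h4 := e1 v hv
        have h5 : Finset.univ.filter (H.Adj v) ⊆ N v := by
          intro u hu
          simp only [N, Finset.mem_filter, Finset.mem_univ, true_and, hHadj] at hu ⊢
          exact (hT v u hu.1).imp id fun h => ⟨h, hu.2.2⟩
        have h6 := Finset.card_le_card h5
        have h7 : (Lz v).card = 0 := hL0 v hv
        have h8 : d + 1 = (N v).card + (Lz v).card := h4
        rw [h8, h7]
        exact h6
      · rw [Finset.filter_eq_empty_iff.2 fun u _ hu => hv ((hHadj v u).1 hu).2.1]
        simp) (hfree.anti fun u v h => ((hHadj u v).1 h).1)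
    refine ⟨hH ω hsymm ?_ ?_, hlam0⟩
    · intro u v huv
      by_contra h
      refine huv ((hHadj u v).2 ⟨?_, hωZ u v h⟩)
      rcases hω u v h with h | h
      · exact hTadj _ _ h.1
      · exact (hTadj _ _ h.1).symm
    · intro v i
      by_cases hv : v ∈ Z
      · simpa [force, hlam0] using hforce v hv i
      · refine Finset.sum_eq_zero fun u _ => ?_
        rw [not_imp_comm.1 (hωZ u v) fun h => hv h.2, zero_mul]

/-! ### Nonsingular square submatrices with few columns at each vertex -/

open Classical in
/-- In a generic realisation of a `t`-sparse `K_{d+2}`-free graph with `2 * t ≤ d + 1`, there are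
as many independent columns of the rigidity matrix as rows, with at most `t` of them at each
vertex. -/
theorem exists_linearIndependent_col [Fintype V] [Fintype L] {G : LoopedGraph V L} (hd : 2 ≤ d)
    {t : ℕ} (ht : 2 * t ≤ d + 1) (hsparse : G.IsSparse t) (hfree : G.graph.CliqueFree (d + 2))
    {p : V → Fin d → ℝ} {q : L → Fin d → ℝ} (hpq : IsGeneric p q) :
    ∃ x : G.graph.edgeSet ⊕ L → V × Fin d,
      (∀ v, (Finset.univ.filter fun r => (x r).1 = v).card ≤ t) ∧
      LinearIndependent ℝ fun r => (G.rigidityMatrix p q).col (x r) := by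
  obtain ⟨f, hf, hfe, hfl⟩ := exists_owner_of_isSparse hsparse
  obtain ⟨T, hTdef⟩ : ∃ T : V → V → Prop,
      ∀ u v, T u v ↔ ∃ h : G.graph.Adj u v, (f (Sum.inl ⟨s(u, v), h⟩)).1 = u :=
    ⟨_, fun _ _ => Iff.rfl⟩
  have hcount : ∀ v, (Finset.univ.filter (T v)).card +
      (Finset.univ.filter fun l => G.base l = v).card ≤ t := by
    intro v
    let φ : V ⊕ L → ℕ := Sum.elim
      (fun u => if h : G.graph.Adj v u then (f (Sum.inl ⟨s(v, u), h⟩)).2 else 0)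
      fun l => (f (Sum.inr l)).2
    rw [← Finset.card_disjSum]
    refine (Finset.card_le_card_of_injOn (t := Finset.range t) φ ?_ ?_).trans_eq
      (Finset.card_range t)
    · rintro (u | l) h
      · simp only [Finset.mem_coe, Finset.inl_mem_disjSum, Finset.mem_filter, Finset.mem_univ,
          true_and, hTdef] at h
        simp [φ, h.1]
      · simp [φ]
    · have hφ : ∀ r r', (f r).1 = v → (f r').1 = v → ((f r).2 : ℕ) = (f r').2 → r = r' :=
        fun r r' h1 h2 h3 => hf (Prod.ext (h1.trans h2.symm) (Fin.ext h3))
      rintro (u | l) h (u' | l') h' heq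
      all_goals
        simp only [Finset.mem_coe, Finset.inl_mem_disjSum, Finset.inr_mem_disjSum,
          Finset.mem_filter, Finset.mem_univ, true_and, hTdef] at h h'
      · simp only [φ, Sum.elim_inl, h.1, h'.1, dif_pos] at heq
        have := hφ _ _ h.2 h'.2 heq
        exact congrArg Sum.inl
          (Sym2.congr_right.1 (congrArg Subtype.val (Sum.inl_injective this)))
      · simp only [φ, Sum.elim_inl, Sum.elim_inr, h.1, dif_pos] at heq
        exact absurd (hφ _ _ h.2 ((hfl l').trans h') heq) (by simp)
      · simp only [φ, Sum.elim_inl, Sum.elim_inr, h'.1, dif_pos] at heq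
        exact absurd (hφ _ _ ((hfl l).trans h) h'.2 heq) (by simp)
      · simp only [φ, Sum.elim_inr] at heq
        have := hφ _ _ ((hfl l).trans h) ((hfl l').trans h') heq
        simpa using this
  have hTswap : ∀ u v (h : G.graph.Adj u v), (f (Sum.inl ⟨s(u, v), h⟩)).1 = v → T v u := by
    intro u v h h1
    refine (hTdef v u).2 ⟨h.symm, Eq.trans ?_ h1⟩
    exact congrArg (fun e => (f (Sum.inl e)).1) (Subtype.ext Sym2.eq_swap)
  have hT : ∀ u v, G.graph.Adj u v → T u v ∨ T v u := by
    intro u v h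
    rcases Sym2.mem_iff.1 (hfe ⟨s(u, v), h⟩) with h1 | h1
    · exact Or.inl ((hTdef u v).2 ⟨h, h1⟩)
    · exact Or.inr (hTswap u v h h1)
  set R := G.rigidityMatrix p q with hR
  obtain ⟨y, hyA, hy⟩ := exists_linearIndependent_transversal (K := ℝ)
    (fun r => Set.range fun i => R.col ((f r).1, i)) (by
      intro J
      let Z : Finset V := J.image fun r => (f r).1
      let M : Matrix J (Z × Fin d) ℝ := R.submatrix Subtype.val fun c => (c.1.1, c.2)
      have hM : LinearIndependent ℝ M.row := by
        rw [Fintype.linearIndependent_iff]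
        intro g hg
        let g' : G.graph.edgeSet ⊕ L → ℝ := fun r => if h : r ∈ J then g ⟨r, h⟩ else 0
        have hg' : ∀ r, g' r ≠ 0 → r ∈ J := fun r h => by
          by_contra hr
          exact h (dif_neg hr)
        obtain ⟨ω, hsymm, hsupp, hω, hforce⟩ := exists_symm_of_row_coeff (d := d) G g'
        have key := eq_zero_of_force_eq_zero hd ht hfree hpq
          (fun u v h => ((hTdef u v).1 h).1) hT hcount Z
          (ω := ω) (lam := fun l => g' (Sum.inr l)) hsymm (by
            intro u v huv
            have hadj : G.graph.Adj u v := not_imp_comm.1 (hsupp u v) huv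
            rw [hω u v hadj] at huv
            have hZ := Finset.mem_image_of_mem (fun r => (f r).1) (hg' _ huv)
            rcases Sym2.mem_iff.1 (hfe ⟨s(u, v), hadj⟩) with h1 | h1
            · exact Or.inl ⟨(hTdef u v).2 ⟨hadj, h1⟩, h1 ▸ hZ⟩
            · exact Or.inr ⟨hTswap u v hadj h1, h1 ▸ hZ⟩)
          (by
            intro l hl
            rw [← hfl l]
            exact Finset.mem_image_of_mem (fun r => (f r).1) (hg' _ hl))
          (by
            intro z hz i
            rw [← hforce]
            have := congrFun hg (⟨z, hz⟩, i)
            simp only [Finset.sum_apply, Pi.smul_apply, smul_eq_mul, Pi.zero_apply] at this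
            rw [← this]
            have hsub : ∑ r, g' r * G.rigidityMatrix p q r (z, i) =
                ∑ r ∈ J, g' r * G.rigidityMatrix p q r (z, i) :=
              (Finset.sum_subset (Finset.subset_univ J) fun r _ hr => by
                rw [not_imp_comm.1 (hg' r) hr, zero_mul]).symm
            rw [hsub, ← Finset.sum_coe_sort J]
            refine Finset.sum_congr rfl fun r _ => ?_
            simp [g', M, hR, Matrix.row])
        rintro ⟨r, hr⟩
        have hgr : g ⟨r, hr⟩ = g' r := by simp [g', hr]
        rw [hgr]
        rcases r with ⟨e, he⟩ | l
        · induction e with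
          | h u v => rw [← hω u v he, key.1]
        · exact key.2 l
      have hrank := hM.rank_matrix
      rw [Matrix.rank_eq_finrank_span_cols, Fintype.card_coe] at hrank
      rw [← hrank]
      -- The column space of `M` is a projection of the span of the columns at `Z`.
      have hle : Submodule.span ℝ (Set.range M.col) ≤
          (Submodule.span ℝ (⋃ j ∈ J, Set.range fun i => R.col ((f j).1, i))).map
            (LinearMap.funLeft ℝ ℝ (Subtype.val : J → _)) := by
        rw [Submodule.map_span]
        refine Submodule.span_mono ?_
        rintro _ ⟨⟨⟨z, hz⟩, i⟩, rfl⟩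
        obtain ⟨r, hr, rfl⟩ := Finset.mem_image.1 hz
        exact ⟨_, Set.mem_biUnion hr ⟨i, rfl⟩, rfl⟩
      exact (Submodule.finrank_mono hle).trans (Submodule.finrank_map_le _ _))
  choose i hi using hyA
  refine ⟨fun r => ((f r).1, i r), fun v => ?_, ?_⟩
  · have hinj : Set.InjOn (fun r => (f r).2)
        (Finset.univ.filter fun r => (f r).1 = v : Finset (G.graph.edgeSet ⊕ L)) := by
      intro r hr r' hr' h
      simp only [Finset.coe_filter, Finset.mem_univ, true_and, Set.mem_ofPred_eq] at hr hr'
      exact hf (Prod.ext (hr.trans hr'.symm) h)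
    simpa using Finset.card_le_card_of_injOn (t := Finset.univ) _ (fun _ _ => by simp) hinj
  · rw [show (fun r => R.col ((f r).1, i r)) = y from funext hi]
    exact hy

/-! ### Necessary conditions for independence -/

open Classical in
theorem inducedCount_eq_card [Fintype V] [Fintype L] (G : LoopedGraph V L) (X : Finset V) :
    G.inducedCount X = (Finset.univ.filter fun e : G.graph.edgeSet => ∀ v ∈ e.1, v ∈ X).card +
      (Finset.univ.filter fun l => G.base l ∈ X).card := by
  rw [inducedCount]
  congr 1
  · rw [← Finset.card_map (Function.Embedding.subtype _), ← Set.ncard_coe_finset]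
    congr 1
    ext e
    simp [and_comm]
  · rw [← Set.ncard_coe_finset]
    congr 1
    ext l
    simp

/-- The rows induced by `X` live in the `d * |X|` columns at `X`. -/
theorem isSparse_of_linearIndependent_row [Finite V] [Finite L] {G : LoopedGraph V L}
    {p : V → Fin d → ℝ} {q : L → Fin d → ℝ}
    (h : LinearIndependent ℝ (G.rigidityMatrix p q).row) : G.IsSparse d := by
  classical
  cases nonempty_fintype V
  cases nonempty_fintype L
  intro X
  let S : Finset (G.graph.edgeSet ⊕ L) :=
    (Finset.univ.filter fun e : G.graph.edgeSet => ∀ v ∈ e.1, v ∈ X).disjSum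
      (Finset.univ.filter fun l => G.base l ∈ X)
  let M : Matrix S (X × Fin d) ℝ :=
    (G.rigidityMatrix p q).submatrix Subtype.val fun c => (c.1.1, c.2)
  have hzero : ∀ r ∈ S, ∀ v ∉ X, ∀ i, G.rigidityMatrix p q r (v, i) = 0 := by
    rintro (⟨e, he⟩ | l) hr v hv i
    · induction e with
      | h a b =>
        simp only [S, Finset.inl_mem_disjSum, Finset.mem_filter, Finset.mem_univ, true_and,
          Sym2.mem_iff, forall_eq_or_imp, forall_eq] at hr
        have ha : v ≠ a := fun h => hv (h ▸ hr.1)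
        have hb : v ≠ b := fun h => hv (h ▸ hr.2)
        simp [rigidityMatrix, ha, hb]
    · simp only [S, Finset.inr_mem_disjSum, Finset.mem_filter, Finset.mem_univ, true_and] at hr
      have hl : v ≠ G.base l := fun h => hv (h ▸ hr)
      simp [rigidityMatrix, hl]
  have hM : LinearIndependent ℝ M.row := by
    have h1 : LinearIndependent ℝ fun r : S => (G.rigidityMatrix p q).row r :=
      h.comp _ Subtype.val_injective
    rw [Fintype.linearIndependent_iff] at h1 ⊢
    intro g hg
    refine h1 g ?_
    ext ⟨v, i⟩
    by_cases hv : v ∈ X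
    · have := congrFun hg (⟨v, hv⟩, i)
      simpa [Finset.sum_apply, M, Matrix.row] using this
    · simp only [Finset.sum_apply, Pi.smul_apply, smul_eq_mul, Pi.zero_apply]
      exact Finset.sum_eq_zero fun r _ => by
        rw [show (G.rigidityMatrix p q).row r (v, i) = 0 from hzero r r.2 v hv i, mul_zero]
  have hcard := hM.fintype_card_le_finrank
  rw [Fintype.card_coe, Finset.card_disjSum] at hcard
  rw [inducedCount_eq_card]
  simpa [mul_comm] using hcard

/-- An affine dependence `c` of the `d + 2` vertices of a clique gives the row dependence with
coefficients `c u * c v`. -/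
theorem cliqueFree_of_linearIndependent_row [Finite V] [Finite L] {G : LoopedGraph V L}
    {p : V → Fin d → ℝ} {q : L → Fin d → ℝ}
    (h : LinearIndependent ℝ (G.rigidityMatrix p q).row) : G.graph.CliqueFree (d + 2) := by
  classical
  cases nonempty_fintype V
  cases nonempty_fintype L
  rw [linearIndependent_row_iff_force] at h
  intro K hK
  -- an affine dependence of the `d + 2` points
  obtain ⟨c, hc, ⟨x, hx⟩, hcx⟩ := Fintype.not_linearIndependent_iff.1
    (show ¬ LinearIndependent ℝ fun u : K => ((p u, 1) : (Fin d → ℝ) × ℝ) from fun hli => by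
      have := hli.fintype_card_le_finrank
      simp [hK.card_eq] at this)
  let c' : V → ℝ := fun u => if h : u ∈ K then c ⟨u, h⟩ else 0
  have hc' : ∀ (F : V → ℝ), ∑ u ∈ K, c' u * F u = ∑ u : K, c u * F u := by
    intro F
    rw [← Finset.sum_coe_sort K]
    exact Finset.sum_congr rfl fun u _ => by simp [c']
  have hc1 : ∑ u ∈ K, c' u = 0 := by
    have := hc' 1
    have h2 := congrArg Prod.snd hc
    simp only [Prod.snd_sum, Prod.smul_snd, smul_eq_mul, Prod.snd_zero, mul_one] at h2
    simp only [Pi.one_apply, mul_one] at this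
    rw [this, h2]
  have hcp : ∀ i, ∑ u ∈ K, c' u * p u i = 0 := by
    intro i
    have h2 := congrFun (congrArg Prod.fst hc) i
    simp only [Prod.fst_sum, Prod.smul_fst, Finset.sum_apply, Pi.smul_apply, smul_eq_mul,
      Prod.fst_zero, Pi.zero_apply] at h2
    rw [hc' fun u => p u i, h2]
  have key := (h (fun u v => if u ≠ v ∧ u ∈ K ∧ v ∈ K then c' u * c' v else 0) 0
    (fun u v => by simp only [ne_comm (a := u), and_comm (a := u ∈ K), mul_comm (c' u)])
    (fun u v huv => if_neg fun h => huv (hK.isClique h.2.1 h.2.2 h.1))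
    (fun v i => by
      simp only [force, Pi.zero_apply, zero_mul, ite_self, Finset.sum_const_zero, add_zero]
      by_cases hv : v ∈ K
      · have h1 : ∀ u, (if u ≠ v ∧ u ∈ K ∧ v ∈ K then c' u * c' v else 0) * (p v i - p u i) =
            if u ∈ K then c' u * c' v * (p v i - p u i) else 0 := by
          intro u
          by_cases huv : u = v
          · subst huv; simp
          · simp [huv, hv]
        simp only [h1]
        rw [← Finset.sum_filter, Finset.filter_mem_eq_inter, Finset.univ_inter]
        have h2 : ∀ u ∈ K, c' u * c' v * (p v i - p u i) =
            c' u * (c' v * p v i) - c' u * p u i * c' v := fun u _ => by ring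
        rw [Finset.sum_congr rfl h2, Finset.sum_sub_distrib, ← Finset.sum_mul, ← Finset.sum_mul,
          hc1, hcp, zero_mul, zero_mul, sub_zero]
      · simp [hv])).1
  have hother : ∀ u ∈ K.erase x, c' u = 0 := by
    intro u hu
    rw [Finset.mem_erase] at hu
    have := key u x
    simpa [hu, hx, c', hcx] using this
  rw [← Finset.add_sum_erase K _ hx, Finset.sum_eq_zero hother, add_zero] at hc1
  exact hcx (by simpa [c', hx] using hc1)

/-! ### Independence of sparse graphs with many loops -/

open Classical in
/-- The sufficiency of sparsity and `K_{d+2}`-freeness for generic independence. -/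
theorem linearIndependent_row_of_isSparse [Fintype V] [Fintype L] {G : LoopedGraph V L}
    (hd : 2 ≤ d) (hloops : ∀ v, d / 2 ≤ G.numLoops v) (hsparse : G.IsSparse d)
    (hfree : G.graph.CliqueFree (d + 2)) {p : V → Fin d → ℝ} {q : L → Fin d → ℝ}
    (hpq : IsGeneric p q) : LinearIndependent ℝ (G.rigidityMatrix p q).row := by
  -- choose `d / 2` loops at each vertex
  have hA : ∀ v, ∃ A : Finset L, A ⊆ Finset.univ.filter (fun l => G.base l = v) ∧
      A.card = d / 2 := by
    intro v
    refine Finset.exists_subset_card_eq ?_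
    rw [← Set.ncard_coe_finset]
    simpa [numLoops] using hloops v
  choose A hA hAcard using hA
  have hAbase : ∀ v, ∀ l ∈ A v, G.base l = v := fun v l hl => by simpa using hA v hl
  let L' := {l // l ∉ A (G.base l)}
  let G' : LoopedGraph V L' := ⟨G.graph, fun l => G.base l⟩
  have hsparse' : G'.IsSparse (d - d / 2) := by
    intro X
    have h1 := hsparse X
    rw [inducedCount_eq_card] at h1 ⊢
    have h2 : (Finset.univ.filter fun l : L' => G'.base l ∈ X).card + d / 2 * X.card =
        (Finset.univ.filter fun l => G.base l ∈ X).card := by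
      have h3 : (X.biUnion A).card = d / 2 * X.card := by
        rw [Finset.card_biUnion]
        · simp [hAcard, mul_comm]
        · intro u _ v _ huv
          rw [Function.onFun, Finset.disjoint_left]
          exact fun l hl hl' => huv ((hAbase u l hl).symm.trans (hAbase v l hl'))
      rw [← h3, ← Finset.card_map (Function.Embedding.subtype _),
        ← Finset.card_union_of_disjoint]
      · congr 1
        ext l
        simp only [Finset.mem_union, Finset.mem_map, Finset.mem_filter, Finset.mem_univ, true_and,
          Finset.mem_biUnion, Function.Embedding.subtype_apply]
        constructor
        · rintro (⟨l, hl, rfl⟩ | ⟨v, hv, hl⟩)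
          · exact hl
          · rwa [hAbase v l hl]
        · intro hl
          by_cases hlA : l ∈ A (G.base l)
          · exact Or.inr ⟨_, hl, hlA⟩
          · exact Or.inl ⟨⟨l, hlA⟩, hl, rfl⟩
      · rw [Finset.disjoint_left]
        intro l hl hl'
        obtain ⟨⟨l, hlA⟩, -, rfl⟩ := Finset.mem_map.1 hl
        obtain ⟨v, -, hv⟩ := Finset.mem_biUnion.1 hl'
        exact hlA (by
          have := hAbase v _ hv
          simp only [Function.Embedding.subtype_apply] at this hv
          rwa [this])
    have h4 : (Finset.univ.filter fun e : G'.graph.edgeSet => ∀ v ∈ e.1, v ∈ X).card =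
      (Finset.univ.filter fun e : G.graph.edgeSet => ∀ v ∈ e.1, v ∈ X).card := rfl
    rw [h4, Nat.sub_mul]
    omega
  obtain ⟨x, hxcount, hx⟩ := exists_linearIndependent_col (G := G') hd (t := d - d / 2) (by omega)
    hsparse' hfree (hpq.comp Function.injective_id (Subtype.val_injective (p := fun l => l ∉ A _)))
  -- the columns at each vertex which are not used leave room for the chosen loops
  have hj : ∀ v, Nonempty (A v ↪ {i : Fin d // ∀ r, x r ≠ (v, i)}) := by
    intro v
    refine Function.Embedding.nonempty_of_card_le ?_
    have h1 : (Finset.univ.filter fun i : Fin d => ¬ ∀ r, x r ≠ (v, i)).card ≤ d - d / 2 := by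
      refine le_trans ?_ (hxcount v)
      refine Finset.card_le_card_of_surjOn (fun r => (x r).2) ?_
      intro i hi
      simp only [Finset.coe_filter, Finset.mem_univ, true_and, Set.mem_ofPred_eq, not_forall,
        not_not] at hi
      obtain ⟨r, hr⟩ := hi
      exact ⟨r, by simp [hr], by simp [hr]⟩
    have h2 := Finset.card_filter_add_card_filter_not (s := (Finset.univ : Finset (Fin d)))
      fun i : Fin d => ∀ r, x r ≠ (v, i)
    rw [Finset.card_univ, Fintype.card_fin] at h2
    rw [Fintype.card_coe, hAcard, Fintype.card_subtype]
    omega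
  let j := fun v => (hj v).some
  let q' : L → Fin d → ℝ := fun l =>
    if h : l ∈ A (G.base l) then Pi.single (j (G.base l) ⟨l, h⟩).1 1 else q l
  refine G.linearIndependent_row_of_isGeneric (p' := p) (q' := q') ?_ hpq
  rw [linearIndependent_row_iff_force]
  intro ω lam hsymm hsupp hf
  -- On the used columns the chosen loops vanish, and the remaining rows form a nonsingular matrix.
  have h0 : ∀ r, Sum.elim (fun e : G'.graph.edgeSet => Sym2.lift ⟨ω, hsymm⟩ e.1)
      (fun l : L' => lam l) r = 0 := by
    set R' := G'.rigidityMatrix p fun l => q l.1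
    have hN : LinearIndependent ℝ (R'.submatrix id x).row := by
      rw [Matrix.linearIndependent_rows_iff_isUnit, ← Matrix.linearIndependent_cols_iff_isUnit]
      exact hx
    rw [Fintype.linearIndependent_iff] at hN
    refine hN _ ?_
    ext r
    simp only [Finset.sum_apply, Pi.smul_apply, smul_eq_mul, Pi.zero_apply]
    refine (sum_mul_rigidityMatrix G' p (fun l => q l.1) ω (fun l : L' => lam l) hsymm hsupp
      (x r).1 (x r).2).trans ?_
    rw [← hf (x r).1 (x r).2, force, force]
    congr 1
    refine Fintype.sum_of_injective Subtype.val Subtype.val_injective _ _ ?_ ?_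
    · intro l hl
      have hlA : l ∈ A (G.base l) := by
        by_contra h
        exact hl ⟨⟨l, h⟩, rfl⟩
      split_ifs with hlx
      · have hne : (x r).2 ≠ (j (G.base l) ⟨l, hlA⟩).1 := by
          intro h
          exact (j (G.base l) ⟨l, hlA⟩).2 r (Prod.ext hlx.symm h)
        simp [q', hlA, hne]
      · rfl
    · rintro ⟨l, hl⟩
      simp [q', hl, G']
  have hω : ∀ u v, ω u v = 0 := by
    intro u v
    by_cases huv : G.graph.Adj u v
    · exact h0 (Sum.inl ⟨s(u, v), huv⟩)
    · exact hsupp u v huv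
  refine ⟨hω, fun l => ?_⟩
  -- Only the chosen loops are left, and their vectors are distinct unit vectors at each vertex.
  by_cases hl : l ∈ A (G.base l)
  · have h1 := hf (G.base l) (j (G.base l) ⟨l, hl⟩).1
    simp only [force, hω, zero_mul, Finset.sum_const_zero, zero_add] at h1
    rw [Finset.sum_eq_single l] at h1
    · simpa [q', hl] using h1
    · intro l' _ hne
      split_ifs with hb
      · by_cases hl' : l' ∈ A (G.base l')
        · have hjne : (j (G.base l) ⟨l, hl⟩).1 ≠ (j (G.base l') ⟨l', hl'⟩).1 := by
            have haux : ∀ v (h : l' ∈ A v), v = G.base l →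
                (j (G.base l) ⟨l, hl⟩).1 ≠ (j v ⟨l', h⟩).1 := by
              rintro v h rfl heq
              have := (j (G.base l)).injective (Subtype.ext heq)
              exact hne (congrArg Subtype.val this).symm
            exact haux _ hl' hb
          simp [q', hl', hjne]
        · have : lam l' = 0 := h0 (Sum.inr ⟨l', hl'⟩)
          rw [this, zero_mul]
      · rfl
    · simp
  · exact h0 (Sum.inr ⟨l, hl⟩)

/-! ### Rigidity and bases of rows -/

theorem sum_rigidityMatrix_mul_edge [Fintype V] (G : LoopedGraph V L) (p : V → Fin d → ℝ)
    (q : L → Fin d → ℝ) (m : V → Fin d → ℝ) {u v : V} (h : G.graph.Adj u v) :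
    ∑ c : V × Fin d, G.rigidityMatrix p q (Sum.inl ⟨s(u, v), h⟩) c * m c.1 c.2 =
      (p u - p v) ⬝ᵥ (m u - m v) := by
  classical
  have h1 : ∀ w i, G.rigidityMatrix p q (Sum.inl ⟨s(u, v), h⟩) (w, i) * m w i =
      (if w = u then (p u i - p v i) * m u i else 0) +
        if w = v then (p v i - p u i) * m v i else 0 := by
    intro w i
    by_cases hu : w = u
    · subst hu
      simp [rigidityMatrix, h.ne]
    · by_cases hv : w = v
      · subst hv
        simp [rigidityMatrix, h.ne']
      · simp [rigidityMatrix, hu, hv]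
  rw [Fintype.sum_prod_type_right, dotProduct]
  refine Finset.sum_congr rfl fun i _ => ?_
  simp only [h1, Finset.sum_add_distrib, Finset.sum_ite_eq', Finset.mem_univ, if_true,
    Pi.sub_apply]
  ring

theorem sum_rigidityMatrix_mul_loop [Fintype V] (G : LoopedGraph V L) (p : V → Fin d → ℝ)
    (q : L → Fin d → ℝ) (m : V → Fin d → ℝ) (l : L) :
    ∑ c : V × Fin d, G.rigidityMatrix p q (Sum.inr l) c * m c.1 c.2 = q l ⬝ᵥ m (G.base l) := by
  classical
  rw [Fintype.sum_prod_type_right, dotProduct]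
  refine Finset.sum_congr rfl fun i _ => ?_
  simp [rigidityMatrix]

theorem isInfinitesimallyRigid_iff_linearIndependent_col [Finite V] (G : LoopedGraph V L)
    (p : V → Fin d → ℝ) (q : L → Fin d → ℝ) :
    G.IsInfinitesimallyRigid p q ↔ LinearIndependent ℝ (G.rigidityMatrix p q).col := by
  cases nonempty_fintype V
  have hmotion : ∀ m : V → Fin d → ℝ, G.IsInfinitesimalMotion p q m ↔
      ∑ c, m c.1 c.2 • (G.rigidityMatrix p q).col c = 0 := by
    intro m
    have hrow : ∀ r, (∑ c, m c.1 c.2 • (G.rigidityMatrix p q).col c) r =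
        ∑ c : V × Fin d, G.rigidityMatrix p q r c * m c.1 c.2 := by
      intro r
      simp [Finset.sum_apply, Matrix.col, mul_comm]
    constructor
    · rintro ⟨h1, h2⟩
      ext r
      rw [hrow]
      rcases r with ⟨e, he⟩ | l
      · induction e with
        | h u v =>
          rw [sum_rigidityMatrix_mul_edge G p q m he]
          exact h1 u v he
      · rw [sum_rigidityMatrix_mul_loop]
        exact h2 l
    · intro h
      refine ⟨fun u v huv => ?_, fun l => ?_⟩
      · rw [← sum_rigidityMatrix_mul_edge G p q m huv, ← hrow, h]
        rfl
      · rw [← sum_rigidityMatrix_mul_loop, ← hrow, h]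
        rfl
  rw [Fintype.linearIndependent_iff]
  constructor
  · intro h g hg c
    exact congrFun (congrFun (h (fun v i => g (v, i)) ((hmotion _).2 hg)) c.1) c.2
  · intro h m hm
    ext v i
    exact h (fun c => m c.1 c.2) ((hmotion m).1 hm) (v, i)

theorem inducedCount_addLoops [Finite V] [Finite L] (G : LoopedGraph V L) (k : ℕ)
    (X : Finset V) : (G.addLoops k).inducedCount X = G.inducedCount X + k * X.card := by
  classical
  cases nonempty_fintype V
  cases nonempty_fintype L
  rw [inducedCount_eq_card, inducedCount_eq_card, add_assoc]
  congr 1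
  have h : (Finset.univ.filter fun l => (G.addLoops k).base l ∈ X) =
      (Finset.univ.filter fun l => G.base l ∈ X).disjSum (X ×ˢ Finset.univ) := by
    ext (l | l) <;> rw [Finset.mem_filter] <;> simp [addLoops]
  rw [h, Finset.card_disjSum, Finset.card_product, Finset.card_univ, Fintype.card_fin, mul_comm k]

theorem le_numLoops_addLoops [Finite V] [Finite L] (G : LoopedGraph V L) (k : ℕ) (v : V) :
    k ≤ (G.addLoops k).numLoops v := by
  have hinj : Function.Injective fun i : Fin k => (Sum.inr (v, i) : L ⊕ V × Fin k) :=
    fun i j h => by simpa using h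
  have h := Set.ncard_le_ncard
    (s := (fun i : Fin k => (Sum.inr (v, i) : L ⊕ V × Fin k)) '' Set.univ)
    (t := {l | (G.addLoops k).base l = v}) (by rintro _ ⟨i, -, rfl⟩; rfl) (Set.toFinite _)
  rwa [Set.ncard_image_of_injective _ hinj, Set.ncard_univ, Nat.card_fin] at h

theorem isSparse_addLoops_iff [Finite V] [Finite L] (G : LoopedGraph V L) (t k : ℕ) :
    (G.addLoops k).IsSparse (t + k) ↔ G.IsSparse t := by
  refine forall_congr' fun X => ?_
  rw [inducedCount_addLoops, add_mul, Nat.add_le_add_iff_right]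

/-- A clique on `d + 2` vertices has `(d + 2) * (d + 1) / 2 > t * (d + 2)` edges. -/
theorem cliqueFree_of_isSparse [Finite V] [Finite L] {G : LoopedGraph V L} {t : ℕ}
    (h : G.IsSparse t) (ht : 2 * t ≤ d) : G.graph.CliqueFree (d + 2) := by
  classical
  cases nonempty_fintype V
  cases nonempty_fintype L
  intro K hK
  have h1 := h K
  have h2 : (K.offDiag.image Sym2.mk.uncurry).card ≤ G.inducedCount K := by
    rw [inducedCount, ← Set.ncard_coe_finset]
    refine le_add_right (Set.ncard_le_ncard ?_ (Set.toFinite _))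
    intro e he
    obtain ⟨⟨u, v⟩, huv, rfl⟩ := Finset.mem_image.1 (Finset.mem_coe.1 he)
    rw [Finset.mem_offDiag] at huv
    exact ⟨hK.isClique huv.1 huv.2.1 huv.2.2, by simp [huv.1, huv.2.1]⟩
  have h3 := Sym2.two_mul_card_image_offDiag K
  rw [Finset.offDiag_card, hK.card_eq, ← Nat.mul_sub_one] at h3
  rw [hK.card_eq] at h1
  have h4 : 2 * t * (d + 2) ≤ d * (d + 2) := Nat.mul_le_mul_right _ ht
  have h5 : (d + 2) * (d + 2 - 1) = d * (d + 2) + (d + 2) := by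
    rw [Nat.add_sub_assoc (by norm_num)]
    ring
  nlinarith

theorem isRigid_addLoops_of_isTight [Finite V] [Finite L] {G : LoopedGraph V L} (hd : 2 ≤ d)
    {t : ℕ} (ht : 2 * t ≤ d + 1) {H : SimpleGraph V} (hH : H ≤ G.graph) {S : Set L}
    (htight : (G.spanningSubgraph H hH S).IsTight t) (hfree : H.CliqueFree (d + 2)) :
    (G.addLoops (d - t)).IsRigid d := by
  classical
  cases nonempty_fintype V
  cases nonempty_fintype L
  let K := (G.spanningSubgraph H hH S).addLoops (d - t)
  obtain ⟨p, q, hpq⟩ := exists_isGeneric V (L ⊕ V × Fin (d - t)) d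
  let ι : S ⊕ V × Fin (d - t) → L ⊕ V × Fin (d - t) := Sum.map Subtype.val id
  have hι : ι.Injective := Sum.map_injective.2 ⟨Subtype.val_injective, Function.injective_id⟩
  have hgen : IsGeneric p fun l => q (ι l) := hpq.comp Function.injective_id hι
  have hrow : LinearIndependent ℝ (K.rigidityMatrix p fun l => q (ι l)).row := by
    refine linearIndependent_row_of_isSparse hd (fun v => ?_) ?_ hfree hgen
    · refine le_trans ?_ (le_numLoops_addLoops _ _ v)
      omega
    · have := (isSparse_addLoops_iff (G.spanningSubgraph H hH S) t (d - t)).2 htight.1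
      rwa [Nat.add_sub_cancel' (by omega)] at this
  refine ⟨p, q, fun m hm => ?_⟩
  have hcard : Fintype.card (K.graph.edgeSet ⊕ (S ⊕ V × Fin (d - t))) =
      Fintype.card (V × Fin d) := by
    have h1 : H.edgeSet.ncard + Nat.card S = t * Nat.card V := htight.2
    have h2 : Fintype.card K.graph.edgeSet = H.edgeSet.ncard :=
      (Nat.card_eq_fintype_card).symm
    rw [Fintype.card_sum, Fintype.card_sum, Fintype.card_prod, Fintype.card_prod, h2,
      ← Nat.card_eq_fintype_card (α := S), ← add_assoc, h1, Nat.card_eq_fintype_card,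
      Fintype.card_fin, Fintype.card_fin, mul_comm t, ← mul_add, Nat.add_sub_cancel' (by omega)]
  have hcol : LinearIndependent ℝ (K.rigidityMatrix p fun l => q (ι l)).col := by
    have h1 := hrow.rank_matrix
    rw [Matrix.rank_eq_finrank_span_cols, hcard] at h1
    exact linearIndependent_iff_card_eq_finrank_span.2 h1.symm
  refine (isInfinitesimallyRigid_iff_linearIndependent_col K p _).2 hcol m ⟨?_, ?_⟩
  · exact fun u v huv => hm.1 u v (hH huv)
  · rintro (l | l)
    · exact hm.2 (Sum.inl l.1)
    · exact hm.2 (Sum.inr l)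

theorem exists_isTight_of_isRigid_addLoops [Finite V] [Finite L] {G : LoopedGraph V L}
    {t : ℕ} (ht : t ≤ d) (hrigid : (G.addLoops (d - t)).IsRigid d) :
    ∃ (H : SimpleGraph V) (hH : H ≤ G.graph) (S : Set L),
      (G.spanningSubgraph H hH S).IsTight t ∧ H.CliqueFree (d + 2) := by
  classical
  cases nonempty_fintype V
  cases nonempty_fintype L
  obtain ⟨p₀, q₀, h₀⟩ := hrigid
  rw [isInfinitesimallyRigid_iff_linearIndependent_col] at h₀
  obtain ⟨p, q, hpq⟩ := exists_isGeneric V (L ⊕ V × Fin (d - t)) d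
  have hcol := linearIndependent_col_of_isGeneric _ h₀ hpq
  set R := (G.addLoops (d - t)).rigidityMatrix p q with hR
  -- the rows of the added loops are independent; extend them to a basis of the row space
  have hRapp : ∀ x v i, R.row (Sum.inr (Sum.inr x)) (v, i) =
      if v = x.1 then q (Sum.inr x) i else 0 := fun x v i =>
    if_congr Iff.rfl rfl rfl
  have hs : LinearIndepOn ℝ R.row (Set.range fun x : V × Fin (d - t) => Sum.inr (Sum.inr x)) := by
    rw [linearIndepOn_range_iff (fun x y h => by simpa using h), Fintype.linearIndependent_iff]
    intro g hg x
    refine eq_zero_of_card_le_of_sum_smul_eq_zero hpq (z := x.1)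
      (T := Finset.univ.map ⟨fun i : Fin (d - t) => Sum.inr (Sum.inr (x.1, i)),
        fun i j h => by simpa using h⟩)
      (c := Sum.elim 0 (Sum.elim 0 g)) (by simp) (by simp) ?_ (Sum.inr (Sum.inr x))
      (by simpa using ⟨x.2, rfl⟩)
    ext i
    have := congrFun hg (x.1, i)
    refine Eq.trans ?_ this
    rw [Finset.sum_map, Finset.sum_apply, Finset.sum_apply, Fintype.sum_prod_type,
      Finset.sum_eq_single x.1]
    · refine Finset.sum_congr rfl fun j _ => ?_
      change g (x.1, j) * _ = g (x.1, j) * R.row (Sum.inr (Sum.inr (x.1, j))) (x.1, i)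
      rw [hRapp, if_pos rfl]
      rfl
    · intro v _ hv
      refine Finset.sum_eq_zero fun j _ => ?_
      change g (v, j) * R.row (Sum.inr (Sum.inr (v, j))) (x.1, i) = 0
      rw [hRapp, if_neg hv.symm, mul_zero]
    · simp
  set B := hs.extend (Set.subset_univ _) with hB
  have hsB := hs.subset_extend (Set.subset_univ _)
  have hBli := hs.linearIndepOn_extend (Set.subset_univ _)
  have hBspan := hs.span_image_extend_eq_span_image (Set.subset_univ _)
  rw [← hB] at hsB hBli hBspan
  have hBcard : Fintype.card B = Fintype.card (V × Fin d) := by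
    have h1 := finrank_span_eq_card hBli
    have h2 : R.rank = Fintype.card (V × Fin d) := by
      rw [Matrix.rank_eq_finrank_span_cols]
      exact finrank_span_eq_card hcol
    rw [Matrix.rank_eq_finrank_span_row] at h2
    rw [Set.image_eq_range, Set.image_univ] at hBspan
    rw [← h1, ← h2, ← hBspan]
  obtain ⟨H, hHadj⟩ : ∃ H : SimpleGraph V, ∀ u v, H.Adj u v ↔
      ∃ h : G.graph.Adj u v, (Sum.inl ⟨s(u, v), h⟩ : (G.addLoops (d - t)).graph.edgeSet ⊕ _) ∈ B :=
    ⟨{ Adj := fun u v => ∃ h : G.graph.Adj u v, Sum.inl ⟨s(u, v), h⟩ ∈ B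
       symm := ⟨fun u v ⟨h, h'⟩ => ⟨h.symm, by
        rwa [show (⟨s(v, u), h.symm⟩ : (G.addLoops (d - t)).graph.edgeSet) = ⟨s(u, v), h⟩ from
          Subtype.ext Sym2.eq_swap]⟩⟩
       loopless := ⟨fun _ ⟨h, _⟩ => G.graph.irrefl h⟩ }, fun _ _ => Iff.rfl⟩
  have hH : H ≤ G.graph := fun u v h => ((hHadj u v).1 h).1
  have hedge : ∀ e (he : e ∈ H.edgeSet),
      (Sum.inl ⟨e, SimpleGraph.edgeSet_mono hH he⟩ :
        (G.addLoops (d - t)).graph.edgeSet ⊕ _) ∈ B := by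
    intro e he
    induction e with
    | h u v => exact ((hHadj u v).1 he).2
  let S : Set L := {l | Sum.inr (Sum.inl l) ∈ B}
  let K := (G.spanningSubgraph H hH S).addLoops (d - t)
  -- the rows of `K` are the rows of `R` indexed by `B`
  let ι : K.graph.edgeSet ⊕ (S ⊕ V × Fin (d - t)) → B := Sum.elim
    (fun e => ⟨_, hedge e.1 e.2⟩)
    (Sum.elim (fun l => ⟨Sum.inr (Sum.inl l.1), l.2⟩)
      fun x => ⟨Sum.inr (Sum.inr x), hsB ⟨x, rfl⟩⟩)
  have hι : ι.Bijective := by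
    constructor
    · rintro (e | l | x) (e' | l' | x') h
      all_goals
        simp [ι] at h
      · exact congrArg Sum.inl (Subtype.ext (Subtype.mk.inj h))
      · rw [Subtype.ext h]
      · rw [h]
    · rintro ⟨⟨e, he⟩ | l | x, hr⟩
      · induction e with
        | h u v => exact ⟨Sum.inl ⟨s(u, v), (hHadj u v).2 ⟨he, hr⟩⟩, rfl⟩
      · exact ⟨Sum.inr (Sum.inl ⟨l, hr⟩), rfl⟩
      · exact ⟨Sum.inr (Sum.inr x), rfl⟩
  have hrow : LinearIndependent ℝ
      (K.rigidityMatrix p fun l => q (Sum.map Subtype.val id l)).row := by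
    have h1 := LinearIndependent.comp hBli ι hι.1
    have h2 : (K.rigidityMatrix p fun l => q (Sum.map Subtype.val id l)).row =
        (fun r : B => R.row r) ∘ ι := by
      ext (e | l | x) c <;> rfl
    rw [h2]
    exact h1
  have hcard := (Fintype.card_of_bijective hι).trans hBcard
  have h2 : Fintype.card K.graph.edgeSet = H.edgeSet.ncard :=
    (Nat.card_eq_fintype_card).symm
  rw [Fintype.card_sum, Fintype.card_sum, Fintype.card_prod, Fintype.card_prod, h2,
    ← Nat.card_eq_fintype_card (α := S), Fintype.card_fin, Fintype.card_fin] at hcard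
  refine ⟨H, hH, S, ⟨?_, ?_⟩, cliqueFree_of_linearIndependent_row hrow⟩
  · rw [← isSparse_addLoops_iff _ t (d - t), Nat.add_sub_cancel' ht]
    exact isSparse_of_linearIndependent_row hrow
  · change H.edgeSet.ncard + Nat.card S = t * Nat.card V
    have h3 : Fintype.card V * d = Fintype.card V * t + Fintype.card V * (d - t) := by
      rw [← mul_add, Nat.add_sub_cancel' ht]
    rw [Nat.card_eq_fintype_card (α := V), mul_comm t]
    omega

end LoopedGraph

theorem mainTheorem1 {V : Type*} {L : Type*} [Finite V] [Finite L] (G : LoopedGraph V L)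
    (d : ℕ) (hd : 2 ≤ d) :
    ((∀ v : V, d / 2 ≤ G.numLoops v) →
      (G.IsIndependent d ↔ G.IsSparse d ∧ G.CompleteFree (d + 2))) ∧
    (∀ t : ℕ, 1 ≤ t → 2 * t ≤ d →
      ((G.addLoops (d - t)).IsRigid d ↔
        ∃ (H : SimpleGraph V) (hH : H ≤ G.graph) (S : Set L),
          (G.spanningSubgraph H hH S).IsTight t)) ∧
    (∀ t : ℕ, d + 1 = 2 * t →
      ((G.addLoops (d - t)).IsRigid d ↔
        ∃ (H : SimpleGraph V) (hH : H ≤ G.graph) (S : Set L),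
          (G.spanningSubgraph H hH S).IsTight t ∧
          (G.spanningSubgraph H hH S).CompleteFree (d + 2))) := by
  cases nonempty_fintype V
  cases nonempty_fintype L
  refine ⟨fun hloops => ⟨fun h => ?_, fun h p q hpq => ?_⟩, fun t _ ht => ⟨fun h => ?_, ?_⟩,
    fun t ht => ⟨fun h => ?_, ?_⟩⟩
  · obtain ⟨p, q, hpq⟩ := LoopedGraph.exists_isGeneric V L d
    exact ⟨LoopedGraph.isSparse_of_linearIndependent_row (h p q hpq),
      LoopedGraph.cliqueFree_of_linearIndependent_row (h p q hpq)⟩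
  · exact LoopedGraph.linearIndependent_row_of_isSparse hd hloops h.1 h.2 hpq
  · obtain ⟨H, hH, S, htight, -⟩ :=
      LoopedGraph.exists_isTight_of_isRigid_addLoops (by omega) h
    exact ⟨H, hH, S, htight⟩
  · rintro ⟨H, hH, S, htight⟩
    exact LoopedGraph.isRigid_addLoops_of_isTight hd (by omega) hH htight
      (LoopedGraph.cliqueFree_of_isSparse htight.1 ht)
  · exact LoopedGraph.exists_isTight_of_isRigid_addLoops (by omega) h
  · rintro ⟨H, hH, S, htight, hfree⟩
    exact LoopedGraph.isRigid_addLoops_of_isTight hd (by omega) hH htight hfree
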